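/- Let $r\ge 1$ and let $F_r$ be the free group with free basis $x_1,\dots,x_r$. Elements of $F_r$ are given as freely reduced words in the $2r$ letters $x_i^{\pm1}$. An element is primitive if it is the image of $x_1$ under some automorphism of $F_r$. The Whitehead graph (without the external edge) of a word $w$ has the $2r$ letters as vertices, and for every pair of consecutive letters $xy$ in $w$ an edge between $x$ and $y^{-1}$; it is complete if any two distinct vertices are joined by an edge. An elementary Whitehead automorphism is given by a letter $a$ and a set $A$ of letters with $a\in A$, $a^{-1}\notin A$: it fixes $a$ and maps every other generator $x\neq a^{\pm1}$ to $a^{-\epsilon}xa^{\delta}$, where $\delta=1$ if $x\in A$ and $\delta=0$ otherwise, and $\epsilon=1$ if $x^{-1}\in A$ and $\epsilon=0$ otherwise. Let $\mathcal A$ be the algorithm that runs the following two procedures in parallel on a cyclically reduced word $u$, and stops as soon as one of them gives an answer. The fast check $\mathcal T$ reads $u$ letter by letter, maintains the Whitehead graph (without the external edge) of the prefix read so far, and answers "not primitive" as soon as this graph is complete; if this never happens, it stops without an answer. The Whitehead algorithm $\mathcal W$ replaces the current cyclically reduced word (initially $u$), as long as possible, by its cyclically reduced image under an elementary Whitehead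 automorphism for which this image is strictly shorter, the automorphisms being tried in some fixed order; it answers "primitive" if the final word has length one, and "not primitive" otherwise. There is a constant $C$ that depends only on $r$ such that the following holds, for every order of the elementary Whitehead automorphisms. 1. Implemented on a (multi-tape) Turing machine, $\mathcal A$ stops on every cyclically reduced word $u$ and decides correctly whether $u$ is primitive; and for every $n\ge 0$, the expected number of steps of $\mathcal A$ on a word chosen uniformly at random among the cyclically reduced words of length $n$ is at most $C$. 2. Implemented on a machine whose memory consists of finitely many double-ended queues, with the first and last letter of every queue accessible in one step, the algorithm that first cyclically reduces its input word (by deleting the first and the last letter as long as they are inverse to each other) and then runs $\mathcal A$ stops on every freely reduced word $u$ and decides correctly whether $u$ is primitive; and for every $n\ge 0$, its expected number of steps on a word chosen uniformly at random among the freely reduced words of length $n$ is at most $C$. -/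

import Mathlib

open scoped ENNReal NNReal

/-! ### Machines with a step count -/

/-- The answer given within `t` steps, if there is one. A step either stops with an answer or leads
to a new configuration; the stopping step is counted. -/
def answerWithin {σ : Type} (step : σ → Bool ⊕ σ) : ℕ → σ → Option Bool
  | 0, _ => none
  | t + 1, c =>
    match step c with
    | Sum.inl b => some b
    | Sum.inr c' => answerWithin step t c'

/-- The number of steps until an answer is given, `⊤` if the computation does not stop. -/
noncomputable def stepCount {σ : Type} (step : σ → Bool ⊕ σ) (c : σ) : ℕ∞ :=
  ⨅ (t : ℕ) (_ : (answerWithin step t c).isSome), (t : ℕ∞)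

/-- A deterministic Turing machine with finitely many two-way infinite tapes, tape alphabet `Γ`
(with blank `default`) and a yes/no answer. In a step it reads the symbols under its heads, and
either stops or changes its state, writes a symbol on every tape and then moves every head by at
most one cell. -/
structure TuringMachine (ι Γ : Type) [Finite ι] [Finite Γ] [Inhabited Γ] where
  State : Type
  finite_state : Finite State
  init : State
  input : ι
  trans : State → (ι → Γ) → Bool ⊕ (State × (ι → Γ × Option Turing.Dir))

namespace TuringMachine

variable {ι Γ : Type} [Finite ι] [Finite Γ] [Inhabited Γ]

/-- A configuration: the state and the tapes. -/
abbrev Cfg (M : TuringMachine ι Γ) : Type := M.State × (ι → Turing.Tape Γ)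

/-- Write a symbol and then move the head, if at all. -/
def applyAct (T : Turing.Tape Γ) (p : Γ × Option Turing.Dir) : Turing.Tape Γ :=
  match p.2 with
  | none => T.write p.1
  | some d => (T.write p.1).move d

def step (M : TuringMachine ι Γ) (c : M.Cfg) : Bool ⊕ M.Cfg :=
  match M.trans c.1 (fun j => (c.2 j).head) with
  | Sum.inl b => Sum.inl b
  | Sum.inr (q, act) => Sum.inr (q, fun j => applyAct (c.2 j) (act j))

/-- The word `u` stands on the input tape, with the head on its first letter; the other tapes are
blank. -/
def start [DecidableEq ι] (M : TuringMachine ι Γ) (u : List Γ) : M.Cfg :=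
  (M.init, fun j => Turing.Tape.mk₁ (if j = M.input then u else []))

/-- On input `u` the machine stops with answer `b`. -/
def Answers [DecidableEq ι] (M : TuringMachine ι Γ) (u : List Γ) (b : Bool) : Prop :=
  ∃ t, answerWithin M.step t (M.start u) = some b

/-- The runtime on input `u`. -/
noncomputable def runtime [DecidableEq ι] (M : TuringMachine ι Γ) (u : List Γ) : ℕ∞ :=
  stepCount M.step (M.start u)

end TuringMachine

/-- The elementary operations on a double-ended queue. -/
inductive DequeOp (Γ : Type) : Type
  | pushFront (c : Γ)
  | pushBack (c : Γ)
  | popFront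
  | popBack

/-- The effect of an operation; popping an empty queue does nothing. -/
def DequeOp.apply {Γ : Type} (l : List Γ) : DequeOp Γ → List Γ
  | pushFront c => c :: l
  | pushBack c => l ++ [c]
  | popFront => l.tail
  | popBack => l.dropLast

/-- A deterministic machine whose memory consists of finitely many double-ended queues. In a step it
sees the first and the last letter of every queue (`none` if the queue is empty), and either stops
or changes its state and performs on every queue a list of elementary operations. There are finitely
many situations, so the number of elementary operations in a step is bounded. -/
structure DequeMachine (ι Γ : Type) [Finite ι] [Finite Γ] where
  State : Type
  finite_state : Finite State
  init : State
  input : ι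
  trans : State → (ι → Option Γ × Option Γ) → Bool ⊕ (State × (ι → List (DequeOp Γ)))

namespace DequeMachine

variable {ι Γ : Type} [Finite ι] [Finite Γ]

/-- A configuration: the state and the queues. -/
abbrev Cfg (M : DequeMachine ι Γ) : Type := M.State × (ι → List Γ)

def step (M : DequeMachine ι Γ) (c : M.Cfg) : Bool ⊕ M.Cfg :=
  match M.trans c.1 (fun j => ((c.2 j).head?, (c.2 j).getLast?)) with
  | Sum.inl b => Sum.inl b
  | Sum.inr (q, act) => Sum.inr (q, fun j => (act j).foldl DequeOp.apply (c.2 j))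

/-- The word `u` stands in the input queue; the other queues are empty. -/
def start [DecidableEq ι] (M : DequeMachine ι Γ) (u : List Γ) : M.Cfg :=
  (M.init, fun j => if j = M.input then u else [])

/-- On input `u` the machine stops with answer `b`. -/
def Answers [DecidableEq ι] (M : DequeMachine ι Γ) (u : List Γ) (b : Bool) : Prop :=
  ∃ t, answerWithin M.step t (M.start u) = some b

/-- The runtime on input `u`. -/
noncomputable def runtime [DecidableEq ι] (M : DequeMachine ι Γ) (u : List Γ) : ℕ∞ :=
  stepCount M.step (M.start u)

end DequeMachine

/-! ### Words, primitive elements, Whitehead automorphisms -/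

/-- The letters `x_i = (i, true)` and `x_i⁻¹ = (i, false)`, as in Mathlib's `FreeGroup`. -/
abbrev Letter (r : ℕ) : Type := Fin r × Bool

/-- The inverse letter. -/
def Letter.inv {r : ℕ} (x : Letter r) : Letter r := (x.1, !x.2)

/-- There is an automorphism of the free group of rank `r` that takes the first generator to `g`. -/
def IsPrimitive {r : ℕ} [NeZero r] (g : FreeGroup (Fin r)) : Prop :=
  ∃ φ : FreeGroup (Fin r) ≃* FreeGroup (Fin r), φ (FreeGroup.of 0) = g

open Classical in
/-- The freely reduced words of length `n`, that is, the elements of length `n` of the free group. -/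
noncomputable def reducedWords (r n : ℕ) : Finset (Fin n → Letter r) :=
  {w | FreeGroup.IsReduced (List.ofFn w)}

open Classical in
/-- The cyclically reduced words of length `n`. -/
noncomputable def cyclicallyReducedWords (r n : ℕ) : Finset (Fin n → Letter r) :=
  {w | FreeGroup.IsCyclicallyReduced (List.ofFn w)}

/-- The expected value of `X` on a uniformly random word of the finite set `S`. -/
noncomputable def expectation {r n : ℕ} (S : Finset (Fin n → Letter r))
    (X : List (Letter r) → ℕ∞) : ℝ≥0∞ :=
  (∑ w ∈ S, (X (List.ofFn w) : ℝ≥0∞)) / (S.card : ℝ≥0∞)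

/-- The data `(a, A)` of an elementary Whitehead automorphism: a letter `a` and a set `A` of letters
that contains `a` but not `a⁻¹`. -/
abbrev WhiteheadDatum (r : ℕ) : Type :=
  {p : Letter r × Finset (Letter r) // p.1 ∈ p.2 ∧ p.1.inv ∉ p.2}

namespace WhiteheadDatum

variable {r : ℕ}

/-- `a` if `x ∈ A`, and the empty word otherwise. -/
def tail (φ : WhiteheadDatum r) (x : Letter r) : FreeGroup (Fin r) :=
  if x ∈ φ.1.2 then FreeGroup.mk [φ.1.1] else 1

/-- The elementary Whitehead automorphism with data `(a, A)`: it fixes `a`, and takes every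
generator `x ≠ a, a⁻¹` to `x`, `x a`, `a⁻¹ x` or `a⁻¹ x a`, where the factor `a` is present if
`x ∈ A`, and the factor `a⁻¹` is present if `x⁻¹ ∈ A`. -/
def hom (φ : WhiteheadDatum r) : FreeGroup (Fin r) →* FreeGroup (Fin r) :=
  FreeGroup.lift fun i =>
    if i = φ.1.1.1 then FreeGroup.of i
    else (φ.tail (i, false))⁻¹ * FreeGroup.of i * φ.tail (i, true)

/-- The letter `x` itself, except that `a` and `a⁻¹` are deleted. -/
def keep (φ : WhiteheadDatum r) (x : Letter r) : Option (Letter r) :=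
  if x.1 = φ.1.1.1 then none else some x

/-- What is to be inserted between the consecutive letters `x` and `y`: the result of cancellation
in `a ^ [x ∈ A] * a ^ (-[y⁻¹ ∈ A])`. -/
def glue (φ : WhiteheadDatum r) (x y : Letter r) : Option (Letter r) :=
  if x ∈ φ.1.2 then (if y.inv ∈ φ.1.2 then none else some φ.1.1)
  else (if y.inv ∈ φ.1.2 then some φ.1.1.inv else none)

/-- The image of the nonempty word `x :: w`, read up to the letter `f` that follows it. -/
def image (φ : WhiteheadDatum r) (f : Letter r) : Letter r → List (Letter r) → List (Letter r)
  | x, [] => (φ.keep x).toList ++ (φ.glue x f).toList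
  | x, y :: w => (φ.keep x).toList ++ (φ.glue x y).toList ++ φ.image f y w

theorem mk_inv (x : Letter r) :
    (FreeGroup.mk [x.inv] : FreeGroup (Fin r)) = (FreeGroup.mk [x])⁻¹ := by
  simp [FreeGroup.inv_mk, FreeGroup.invRev, Letter.inv]

theorem mk_glue (φ : WhiteheadDatum r) (x y : Letter r) :
    (FreeGroup.mk (φ.glue x y).toList : FreeGroup (Fin r)) = φ.tail x * (φ.tail y.inv)⁻¹ := by
  unfold glue tail
  split_ifs
  · rw [mul_inv_cancel]; rfl
  · simp
  · simp [mk_inv]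
  · simp [← FreeGroup.one_eq_mk]

theorem hom_letter (φ : WhiteheadDatum r) (x : Letter r) :
    φ.hom (FreeGroup.mk [x]) =
      (φ.tail x.inv)⁻¹ * FreeGroup.mk (φ.keep x).toList * φ.tail x := by
  obtain ⟨⟨⟨k, c⟩, A⟩, ha, ha'⟩ := φ
  obtain ⟨i, d⟩ := x
  simp only [Letter.inv] at ha ha'
  have hm : (FreeGroup.mk [(i, false)] : FreeGroup (Fin r)) = (FreeGroup.of i)⁻¹ :=
    mk_inv (i, true)
  have ht : (FreeGroup.mk [(i, true)] : FreeGroup (Fin r)) = FreeGroup.of i := rfl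
  by_cases h : i = k
  · subst h
    cases c <;> cases d <;> simp only [Bool.not_true, Bool.not_false] at ha' <;>
      simp [hom, tail, keep, Letter.inv, hm, ht, ha, ha', ← FreeGroup.one_eq_mk]
  · cases d
    · simp only [hom, tail, keep, Letter.inv, hm, map_inv, FreeGroup.lift_apply_of, h, if_false,
        Option.toList, Bool.not_false]
      group
    · simp only [hom, tail, keep, Letter.inv, ht, FreeGroup.lift_apply_of, h, if_false,
        Option.toList, Bool.not_true]

/-- Letting `f = x`, the word `image` represents a conjugate of the image of `x :: w` under the
Whitehead automorphism; that is, it represents the image of the cyclic word `x :: w`. -/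
theorem mk_image (φ : WhiteheadDatum r) (f x : Letter r) (w : List (Letter r)) :
    (FreeGroup.mk (φ.image f x w) : FreeGroup (Fin r)) =
      φ.tail x.inv * φ.hom (FreeGroup.mk (x :: w)) * (φ.tail f.inv)⁻¹ := by
  induction w generalizing x with
  | nil =>
    rw [image, ← FreeGroup.mul_mk, mk_glue, hom_letter]
    group
  | cons y w ih =>
    have h : (FreeGroup.mk (x :: y :: w) : FreeGroup (Fin r)) =
        FreeGroup.mk [x] * FreeGroup.mk (y :: w) := by
      rw [FreeGroup.mul_mk]; rfl
    rw [image, ← FreeGroup.mul_mk, ← FreeGroup.mul_mk, mk_glue, ih, h, map_mul, hom_letter]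
    group

end WhiteheadDatum

/-! ### The algorithm -/

/-- The number of elementary Whitehead automorphisms. -/
abbrev numWhitehead (r : ℕ) : ℕ := Fintype.card (WhiteheadDatum r)

/-- The edges added to a Whitehead graph (without the external edge) when the letter `y` is read
after the letter `p` (if any): an edge from `p` to `y⁻¹`. -/
def addEdge {r : ℕ} (E : Finset (Sym2 (Letter r))) : Option (Letter r) → Letter r →
    Finset (Sym2 (Letter r))
  | none, _ => E
  | some x, y => insert s(x, y.inv) E

/-- Any two vertices are connected by an edge. -/
abbrev IsCompleteGraph {r : ℕ} (E : Finset (Sym2 (Letter r))) : Prop :=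
  ∀ x y : Letter r, x ≠ y → s(x, y) ∈ E

/-- The states of the algorithm. Tape `0` is the input tape; one of the tapes `1` and `2` contains
the current word of the Whitehead algorithm, the other one the image of the current word under the
Whitehead automorphism that is being tried. The entry `b` tells which is which, and `i` is the
index of the automorphism. -/
inductive AState (r : ℕ) : Type
  /-- the fast check has found the edges `E` and has read `p` last; the Whitehead algorithm copies
  the input to its work tape -/
  | read (E : Finset (Sym2 (Letter r))) (p : Option (Letter r))
  /-- the head of the current word goes back to its beginning -/
  | rewind (b : Bool) (i : Fin (numWhitehead r + 1))
  /-- the head of the current word is at its beginning -/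
  | begins (b : Bool) (i : Fin (numWhitehead r + 1))
  /-- the image of the letter `x` is to be written; the current word begins with `f` -/
  | keep (b : Bool) (i : Fin (numWhitehead r)) (f x : Letter r)
  /-- the letter between the images of `x` and of the letter after it is to be written -/
  | glue (b : Bool) (i : Fin (numWhitehead r)) (f x : Letter r)
  /-- the image is complete, both heads are behind their words -/
  | turn (b : Bool) (i : Fin (numWhitehead r))
  /-- compare the lengths of the current word and of its image -/
  | compare (b : Bool) (i : Fin (numWhitehead r))
  /-- the head of the work tape that is not needed any more goes to the end of its word -/
  | seek (b : Bool) (i : Fin (numWhitehead r + 1))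
  /-- that word is erased -/
  | wipe (b : Bool) (i : Fin (numWhitehead r + 1))
  /-- no automorphism makes the current word shorter: is there a second letter? -/
  | final (b : Bool)
  deriving Fintype

/-- The tape with the current word. -/
def curTape (b : Bool) : Fin 3 := if b then 2 else 1

/-- The tape with the image of the current word. -/
def imgTape (b : Bool) : Fin 3 := if b then 1 else 2

/-- Change the action `act` on tape `j`: write `c` and move as `d` says. -/
def onTape {r : ℕ} (act : Fin 3 → Option (Letter r) × Option Turing.Dir) (j : Fin 3)
    (c : Option (Letter r)) (d : Option Turing.Dir) : Fin 3 → Option (Letter r) × Option Turing.Dir :=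
  Function.update act j (c, d)

/-- Append the letter, if there is one, to the word on tape `j`, whose head is behind the word. -/
def appendTo {r : ℕ} (act : Fin 3 → Option (Letter r) × Option Turing.Dir) (j : Fin 3) :
    Option (Letter r) → Fin 3 → Option (Letter r) × Option Turing.Dir
  | none => act
  | some c => onTape act j (some c) (some .right)

/-- The transition function of the algorithm, given an enumeration `e` of the Whitehead
automorphisms. -/
def aTrans {r : ℕ} (e : Fin (numWhitehead r) ≃ WhiteheadDatum r) (q : AState r)
    (s : Fin 3 → Option (Letter r)) :
    Bool ⊕ (AState r × (Fin 3 → Option (Letter r) × Option Turing.Dir)) :=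
  let idle : Fin 3 → Option (Letter r) × Option Turing.Dir := fun j => (s j, none)
  let move (act : Fin 3 → Option (Letter r) × Option Turing.Dir) (j : Fin 3) (d : Turing.Dir) :=
    onTape act j (s j) (some d)
  match q with
  | .read E p =>
    match s 0 with
    | none => .inr (.rewind false 0, move idle (curTape false) .left)
    | some y =>
      if IsCompleteGraph (addEdge E p y) then .inl false
      else .inr (.read (addEdge E p y) (some y),
        appendTo (move idle 0 .right) (curTape false) (some y))
  | .rewind b i =>
    match s (curTape b) with
    | some _ => .inr (.rewind b i, move idle (curTape b) .left)
    | none => .inr (.begins b i, move idle (curTape b) .right)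
  | .begins b i =>
    match s (curTape b) with
    | none => .inl false
    | some y =>
      if h : i.1 < numWhitehead r then .inr (.keep b ⟨i.1, h⟩ y y, move idle (curTape b) .right)
      else .inr (.final b, move idle (curTape b) .right)
  | .keep b i f x => .inr (.glue b i f x, appendTo idle (imgTape b) ((e i).keep x))
  | .glue b i f x =>
    match s (curTape b) with
    | some y => .inr (.keep b i f y,
        appendTo (move idle (curTape b) .right) (imgTape b) ((e i).glue x y))
    | none => .inr (.turn b i, appendTo idle (imgTape b) ((e i).glue x f))
  | .turn b i => .inr (.compare b i, move (move idle (curTape b) .left) (imgTape b) .left)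
  | .compare b i =>
    match s (curTape b), s (imgTape b) with
    | some _, some _ => .inr (.compare b i, move (move idle (curTape b) .left) (imgTape b) .left)
    -- the image is shorter: it becomes the current word, and the old one is erased
    | some _, none => .inr (.seek (!b) 0, move idle (curTape b) .right)
    -- the image is not shorter: it is erased, and the next automorphism is tried
    | none, _ => .inr (.seek b i.succ, move idle (imgTape b) .right)
  | .seek b i =>
    match s (imgTape b) with
    | some _ => .inr (.seek b i, move idle (imgTape b) .right)
    | none => .inr (.wipe b i, move idle (imgTape b) .left)
  | .wipe b i =>
    match s (imgTape b) with
    | some _ => .inr (.wipe b i, onTape idle (imgTape b) none (some .left))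
    | none => .inr (.rewind b i, idle)
  | .final b =>
    match s (curTape b) with
    | none => .inl true
    | some _ => .inl false

/-- The fast check in parallel with the Whitehead algorithm, on a Turing machine. While the input is
read for the first time, the fast check builds the Whitehead graph of the prefix read so far and
stops with the answer "not primitive" as soon as this graph is complete; at the same time the
Whitehead algorithm copies the input. When the input is exhausted, the Whitehead algorithm goes on:
as long as there is an elementary Whitehead automorphism that makes the current cyclic word shorter,
it applies the first one; the answer is "primitive" if the final word has length one. -/
def algorithmA {r : ℕ} (e : Fin (numWhitehead r) ≃ WhiteheadDatum r) :
    TuringMachine (Fin 3) (Option (Letter r)) where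
  State := AState r
  finite_state := inferInstance
  init := .read ∅ none
  input := 0
  trans := aTrans e

/-- The operations that perform a Turing machine action on a tape kept in two queues: the queue
`true` contains the symbol under the head and the symbols to the right of it, the queue `false` those
to the left of the head, the nearest one first. Here `l` is the symbol to the left of the head. -/
def tapeOps {Γ : Type} (l : Γ) : Γ × Option Turing.Dir → Bool → List (DequeOp Γ)
  | (c, none), true => [.popFront, .pushFront c]
  | (_, none), false => []
  | (_, some .right), true => [.popFront]
  | (c, some .right), false => [.pushFront c]
  | (c, some .left), true => [.popFront, .pushFront c, .pushFront l]
  | (_, some .left), false => [.popFront]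

/-- Are these the first and the last letter of a word that is not cyclically reduced? -/
def cancels {r : ℕ} : Option (Option (Letter r)) × Option (Option (Letter r)) → Bool
  | (some (some a), some (some z)) => z = a.inv
  | _ => false

/-- The algorithm on a machine with double-ended queues: as long as the last letter of the word in
the input queue is the inverse of the first one, both are deleted; then the algorithm above is
carried out step by step, every tape being kept in two queues. -/
def dequeAlgorithm {r : ℕ} (e : Fin (numWhitehead r) ≃ WhiteheadDatum r) :
    DequeMachine (Fin 3 × Bool) (Option (Letter r)) where
  State := Option (AState r)
  finite_state := inferInstance
  init := none
  input := (0, true)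
  trans
    | none, s =>
      if cancels (s (0, true)) then
        .inr (none, fun j => if j = (0, true) then [.popFront, .popBack] else [])
      else .inr (some (.read ∅ none), fun _ => [])
    | some q, s =>
      match aTrans e q (fun j => ((s (j, true)).1).getD none) with
      | .inl b => .inl b
      | .inr (q', act) =>
        .inr (some q', fun j => tapeOps (((s (j.1, false)).1).getD none) (act j.1) j.2)

/-! ### Labelled graphs and Stallings folds -/

/-! Correctness rests on one fact about bases, obtained by Stallings folds. Represent a basis by
loops in a wedge of subdivided circles. Since the loops generate the free group, every connected
graph carrying them with at least two vertices admits a fold of two edges with distinct ends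
(`IsLoops.exists_fold`), which removes a vertex and at least one edge. Stop just before the rose:
two vertices, at most r + 1 edges, and every generator occurs as a label. Hence one label `a` occurs
on exactly two edges, a loop and an edge joining the two vertices, and every other label occurs
once. Taking for `A` the labels of the edges that end at the far vertex gives a Whitehead datum
(`exists_two_vertex_graph`). Contracting the joining edge also gives a rose; on loops this is, up to
conjugation, the Whitehead automorphism of `(a, A)`, which therefore deletes the letters read along
the joining edge (`Follows.hom_eq`).

Two consequences follow. First, among all bases extending a primitive element, take one whose other
members have minimal total length. If the given word avoided the joining edge, the automorphism
would preserve it and shorten another member; so the word itself becomes shorter as a cyclic word,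
and greedy reduction cannot get stuck above length one (`exists_image_length_lt`). Second, in the
Whitehead graph of a cyclically reduced primitive word, `a` separates the rest of `A` from `a⁻¹`, so
the graph is not complete and the fast check is sound (`exists_missing_edge`).

For the expected time, the Whitehead algorithm is quadratic (`AlgorithmA.answerWithin_begins`). For
some fixed length L, every letter can be followed by L letters that make the graph complete, so the
proportion of prefixes with incomplete graph decays exponentially (`exists_card_badLists_le`). The
expected number of letters read is then bounded by a geometric series, and the quadratic fallback is
multiplied by an exponentially small probability. Cyclically reduced words make up at least 1/(2r)
of the reduced ones, which transfers the bound to them. For the queues, stripping a cancelling pair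
leaves a reduced word of length n - 2, and the resulting recurrence closes because 2r/(2r-1)² ≤ 1/2
when r ≥ 2 (`sum_time_le`). -/

theorem Letter.inv_inv {r : ℕ} (x : Letter r) : x.inv.inv = x := by
  simp [Letter.inv]

theorem Letter.inv_ne {r : ℕ} (x : Letter r) : x.inv ≠ x := by
  intro h
  have := congrArg Prod.snd h
  simp [Letter.inv] at this

theorem Letter.eq_or_eq_inv {r : ℕ} {x y : Letter r} (h : x.1 = y.1) : x = y ∨ x = y.inv := by
  obtain ⟨i, b⟩ := x
  obtain ⟨j, c⟩ := y
  cases b <;> cases c <;> simp_all [Letter.inv]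

namespace Folding

variable {r : ℕ} {V W : Type}

/-- The edge from `u` to `v` with label `x`, oriented such that its label is a generator. -/
def posEdge (u : V) (x : Letter r) (v : V) : V × Fin r × V :=
  if x.2 then (u, x.1, v) else (v, x.1, u)

theorem posEdge_inv (u : V) (x : Letter r) (v : V) : posEdge v x.inv u = posEdge u x v := by
  rcases x with ⟨i, _ | _⟩ <;> rfl

theorem posEdge_label (u : V) (x : Letter r) (v : V) : (posEdge u x v).2.1 = x.1 := by
  rcases x with ⟨i, _ | _⟩ <;> rfl

theorem posEdge_inj {u u' v v' : V} {x : Letter r} :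
    posEdge u x v = posEdge u' x v' ↔ u = u' ∧ v = v' := by
  rcases x with ⟨i, _ | _⟩ <;> simp [posEdge, and_comm]

theorem posEdge_map (f : V → W) (u : V) (x : Letter r) (v : V) :
    Prod.map f (Prod.map id f) (posEdge u x v) = posEdge (f u) x (f v) := by
  rcases x with ⟨i, _ | _⟩ <;> rfl

/-- The word `l` can be read along a path from `u` to `v`. -/
def Reads (E : Finset (V × Fin r × V)) : V → List (Letter r) → V → Prop
  | u, [], v => u = v
  | u, x :: l, v => ∃ m, posEdge u x m ∈ E ∧ Reads E m l v

theorem Reads.append {E : Finset (V × Fin r × V)} {u v z : V} {l l' : List (Letter r)}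
    (h : Reads E u l v) (h' : Reads E v l' z) : Reads E u (l ++ l') z := by
  induction l generalizing u with
  | nil => cases h; exact h'
  | cons x l ih =>
    obtain ⟨m, hm, h⟩ := h
    exact ⟨m, hm, ih h⟩

theorem reads_append {E : Finset (V × Fin r × V)} {u z : V} {l l' : List (Letter r)} :
    Reads E u (l ++ l') z ↔ ∃ v, Reads E u l v ∧ Reads E v l' z := by
  refine ⟨fun h => ?_, fun ⟨v, h, h'⟩ => h.append h'⟩
  induction l generalizing u with
  | nil => exact ⟨u, rfl, h⟩
  | cons x l ih =>
    obtain ⟨m, hm, h⟩ := h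
    obtain ⟨v, hv, hv'⟩ := ih h
    exact ⟨v, ⟨m, hm, hv⟩, hv'⟩

theorem Reads.invRev {E : Finset (V × Fin r × V)} {u v : V} {l : List (Letter r)}
    (h : Reads E u l v) : Reads E v (FreeGroup.invRev l) u := by
  induction l generalizing u with
  | nil => cases h; rfl
  | cons x l ih =>
    obtain ⟨m, hm, h⟩ := h
    have : FreeGroup.invRev (x :: l) = FreeGroup.invRev l ++ [x.inv] := by
      simp [FreeGroup.invRev, Letter.inv]
    rw [this]
    exact (ih h).append ⟨u, by rwa [posEdge_inv], rfl⟩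

/-- In a graph in which no two edges can be folded, words can be freely reduced along a path. -/
theorem Reads.red {E : Finset (V × Fin r × V)}
    (hE : ∀ u x v v', posEdge u x v ∈ E → posEdge u x v' ∈ E → v = v')
    {u v : V} {l l' : List (Letter r)} (hr : FreeGroup.Red l l') (h : Reads E u l v) :
    Reads E u l' v := by
  induction hr with
  | refl => exact h
  | tail _ hs ih =>
    rcases hs with ⟨⟩
    rename_i l₁ l₂ x b _
    obtain ⟨p, h₁, q, hq, p', hp', h₂⟩ := reads_append.1 ih
    -- The cancelled pair leads from `p` to `q` and back to `p'` along the same label, so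
    -- determinism at `q` closes the detour.
    have : p' = p := by
      refine hE q (x, !b) p' p hp' ?_
      have := posEdge_inv p (x, b) q
      simp only [Letter.inv] at this
      rwa [this]
    subst this
    exact h₁.append h₂

/-- The edges traversed by closed paths with the labels `w i`, where `T i k` is the vertex at time
`k` of the path with label `w i`. -/
def traceEdges [DecidableEq V] (w : Fin r → List (Letter r)) (T : Fin r → ℕ → V) :
    Finset (V × Fin r × V) :=
  Finset.univ.image fun p : (i : Fin r) × Fin (w i).length =>
    posEdge (T p.1 p.2) (w p.1)[p.2] (T p.1 (p.2 + 1))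

/-- Every `T i` describes the vertices of a path with label `w i` that begins and ends at `v₀`, and
every vertex is met. -/
structure IsLoops (w : Fin r → List (Letter r)) (T : Fin r → ℕ → V) (v₀ : V) : Prop where
  start : ∀ i, T i 0 = v₀
  finish : ∀ i, T i (w i).length = v₀
  surj : ∀ v, ∃ i k, k ≤ (w i).length ∧ T i k = v

variable {w : Fin r → List (Letter r)} {T : Fin r → ℕ → V} {v₀ : V}

theorem posEdge_mem_traceEdges [DecidableEq V] (i : Fin r) {k : ℕ} (hk : k < (w i).length) :
    posEdge (T i k) (w i)[k] (T i (k + 1)) ∈ traceEdges w T :=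
  Finset.mem_image.2 ⟨⟨i, ⟨k, hk⟩⟩, Finset.mem_univ _, rfl⟩

theorem traceEdges_comp [DecidableEq V] [DecidableEq W] (f : V → W) :
    traceEdges w (fun i k => f (T i k)) =
      (traceEdges w T).image (Prod.map f (Prod.map id f)) := by
  rw [traceEdges, traceEdges, Finset.image_image]
  congr 1
  funext p
  exact (posEdge_map f _ _ _).symm

theorem IsLoops.comp (h : IsLoops w T v₀) {f : V → W} (hf : Function.Surjective f) :
    IsLoops w (fun i k => f (T i k)) (f v₀) where
  start i := by rw [h.start]
  finish i := by rw [h.finish]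
  surj v := by
    obtain ⟨u, rfl⟩ := hf v
    obtain ⟨i, k, hk, rfl⟩ := h.surj u
    exact ⟨i, k, hk, rfl⟩

theorem IsLoops.reads_take [DecidableEq V] (h : IsLoops w T v₀) (i : Fin r) {k : ℕ}
    (hk : k ≤ (w i).length) : Reads (traceEdges w T) v₀ ((w i).take k) (T i k) := by
  induction k with
  | zero => exact (h.start i).symm
  | succ k ih =>
    rw [List.take_succ_eq_append_getElem (by omega)]
    exact (ih (by omega)).append ⟨_, posEdge_mem_traceEdges i (by omega), rfl⟩

theorem IsLoops.connected [DecidableEq V] (h : IsLoops w T v₀) (v : V) :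
    ∃ l, Reads (traceEdges w T) v₀ l v := by
  obtain ⟨i, k, hk, rfl⟩ := h.surj v
  exact ⟨_, h.reads_take i hk⟩

/-- Closed paths at `v₀` can be concatenated and reversed, so the elements they represent form a
subgroup; it contains all `w i`. -/
theorem IsLoops.exists_reads [DecidableEq V] (h : IsLoops w T v₀)
    (hw : Subgroup.closure (Set.range fun i => FreeGroup.mk (w i)) = ⊤) (g : FreeGroup (Fin r)) :
    ∃ l, Reads (traceEdges w T) v₀ l v₀ ∧ FreeGroup.mk l = g := by
  have hg : g ∈ Subgroup.closure (Set.range fun i => FreeGroup.mk (w i)) := hw ▸ Subgroup.mem_top g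
  induction hg using Subgroup.closure_induction with
  | mem x hx =>
    obtain ⟨i, rfl⟩ := hx
    refine ⟨w i, ?_, rfl⟩
    have := h.reads_take i le_rfl
    rwa [List.take_length, h.finish] at this
  | one => exact ⟨[], rfl, rfl⟩
  | mul x y _ _ hx hy =>
    obtain ⟨l, hl, rfl⟩ := hx
    obtain ⟨l', hl', rfl⟩ := hy
    exact ⟨l ++ l', hl.append hl', by rw [FreeGroup.mul_mk]⟩
  | inv x _ hx =>
    obtain ⟨l, hl, rfl⟩ := hx
    exact ⟨_, hl.invRev, by rw [FreeGroup.inv_mk]⟩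

/-- A graph that maps onto the rose on the level of fundamental groups is the rose, or has two edges
that can be folded. -/
theorem IsLoops.exists_fold [DecidableEq V] [Nontrivial V] (h : IsLoops w T v₀)
    (hw : Subgroup.closure (Set.range fun i => FreeGroup.mk (w i)) = ⊤) :
    ∃ u x v v', posEdge u x v ∈ traceEdges w T ∧ posEdge u x v' ∈ traceEdges w T ∧ v ≠ v' := by
  by_contra! hE
  -- A closed path representing `x` can be reduced to the one-letter word without leaving the graph,
  -- which yields a loop edge labelled `x` at `v₀`.
  have hloop : ∀ x, posEdge v₀ x v₀ ∈ traceEdges w T := by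
    intro x
    obtain ⟨l, hl, hx⟩ := h.exists_reads hw (FreeGroup.mk [x])
    have hred : FreeGroup.Red l [x] := by
      have h1 : FreeGroup.reduce l = [x] := by
        rw [FreeGroup.reduce.sound hx, FreeGroup.reduce_singleton]
      rw [← h1]
      exact FreeGroup.reduce.red
    obtain ⟨m, hm, rfl⟩ := hl.red hE hred
    exact hm
  -- By determinism these loop edges are the only edges at `v₀`, so no path leaves it; this
  -- contradicts connectedness.
  have hall : ∀ l v, Reads (traceEdges w T) v₀ l v → v₀ = v := by
    intro l
    induction l with
    | nil => exact fun v h => h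
    | cons x l ih =>
      rintro v ⟨m, hm, hl⟩
      have := hE _ _ _ _ hm (hloop x)
      subst this
      exact ih v hl
  obtain ⟨v, hv⟩ := exists_ne v₀
  obtain ⟨l, hl⟩ := h.connected v
  exact hv (hall l v hl).symm

/-- Every generator is the label of an edge. -/
theorem IsLoops.exists_label [DecidableEq V] (h : IsLoops w T v₀)
    (hw : Subgroup.closure (Set.range fun i => FreeGroup.mk (w i)) = ⊤) (j : Fin r) :
    ∃ e ∈ traceEdges w T, e.2.1 = j := by
  by_contra! hj
  -- The exponent sum of the generator `j`: without edges labelled `j` it would vanish on all closed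
  -- paths, hence on the whole group.
  let ψ : FreeGroup (Fin r) →* Multiplicative ℤ :=
    FreeGroup.lift fun i => if i = j then Multiplicative.ofAdd 1 else 1
  have hψ : ∀ l u v, Reads (traceEdges w T) u l v → ψ (FreeGroup.mk l) = 1 := by
    intro l
    induction l with
    | nil => intro u v _; rw [← FreeGroup.one_eq_mk, map_one]
    | cons x l ih =>
      rintro u v ⟨m, hm, hl⟩
      have h5 : FreeGroup.mk (x :: l) = FreeGroup.mk [x] * FreeGroup.mk l := by
        rw [FreeGroup.mul_mk]; rfl
      have hx := hj _ hm
      rw [posEdge_label] at hx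
      rw [h5, map_mul, ih _ _ hl, mul_one, FreeGroup.lift_mk]
      simp [hx]
  obtain ⟨l, hl, hlj⟩ := h.exists_reads hw (FreeGroup.of j)
  have := hψ l _ _ hl
  rw [hlj] at this
  simp [ψ] at this

/-- There are loops with labels `w i` in a connected graph with `m` vertices, whose fundamental
group has rank at most `r`. -/
def HasLoopGraph (w : Fin r → List (Letter r)) (m : ℕ) : Prop :=
  ∃ (V : Type) (_ : Fintype V) (_ : DecidableEq V) (T : Fin r → ℕ → V) (v₀ : V),
    IsLoops w T v₀ ∧ Fintype.card V = m ∧ (traceEdges w T).card + 1 ≤ m + r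

/-- The wedge of `r` circles. -/
theorem hasLoopGraph_wedge [NeZero r] (hne : ∀ i, w i ≠ []) :
    HasLoopGraph w (1 + ∑ i, ((w i).length - 1)) := by
  classical
  let V := Option ((i : Fin r) × Fin ((w i).length - 1))
  -- Every time strictly inside a word gets its own vertex; the first and the last time give the
  -- base point `none`.
  let T : Fin r → ℕ → V := fun i k =>
    if h : 0 < k ∧ k < (w i).length then some ⟨i, ⟨k - 1, by omega⟩⟩ else none
  refine ⟨V, inferInstance, inferInstance, T, none, ⟨fun i => ?_, fun i => ?_, ?_⟩, ?_, ?_⟩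
  · simp [T]
  · simp [T]
  · rintro (_ | ⟨i, k, hk⟩)
    · exact ⟨0, 0, by omega, by simp [T]⟩
    · refine ⟨i, k + 1, by omega, ?_⟩
      have : k + 1 < (w i).length := by omega
      simp [T, this]
  · simp [V, add_comm]
  · have h1 : (traceEdges w T).card ≤ ∑ i, (w i).length := by
      refine Finset.card_image_le.trans ?_
      simp
    have h2 : ∑ i, (w i).length = ∑ i, ((w i).length - 1) + r := by
      have : ∀ i, (w i).length = ((w i).length - 1) + 1 := fun i => by
        have := List.length_pos_iff.2 (hne i)
        omega
      rw [Finset.sum_congr rfl (fun i _ => this i), Finset.sum_add_distrib]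
      simp
    omega

/-- Identifying the ends of the folded edges merges these two edges: one vertex and at least one
edge disappear, so the bound on the rank persists. -/
theorem HasLoopGraph.fold {m : ℕ} (hm : 3 ≤ m) (h : HasLoopGraph w m)
    (hw : Subgroup.closure (Set.range fun i => FreeGroup.mk (w i)) = ⊤) :
    HasLoopGraph w (m - 1) := by
  obtain ⟨V, _, _, T, v₀, hT, rfl, hcard⟩ := h
  have : Nontrivial V := Fintype.one_lt_card_iff_nontrivial.1 (by omega)
  obtain ⟨u, x, v, v', he, he', hne⟩ := hT.exists_fold hw
  let f : V → {z : V // z ≠ v'} := fun z => if h : z = v' then ⟨v, hne⟩ else ⟨z, h⟩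
  have hf : Function.Surjective f := fun ⟨z, hz⟩ => ⟨z, by simp [f, hz]⟩
  have hfv : f v = f v' := by simp [f, hne]
  refine ⟨{z : V // z ≠ v'}, inferInstance, inferInstance, _, _, hT.comp hf, ?_, ?_⟩
  · simp
  · have hlt : (traceEdges w fun i k => f (T i k)).card < (traceEdges w T).card := by
      rw [traceEdges_comp]
      refine lt_of_le_of_ne Finset.card_image_le fun heq => ?_
      have hinj := Finset.card_image_iff.1 heq he he' (by rw [posEdge_map, posEdge_map, hfv])
      exact hne (posEdge_inj.1 hinj).2
    omega

/-- Fold the wedge until two vertices remain; a word of length at least two guarantees that the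
wedge has at least two to begin with. -/
theorem hasLoopGraph_two [NeZero r] (hne : ∀ i, w i ≠ []) (hlong : ∃ i, 2 ≤ (w i).length)
    (hw : Subgroup.closure (Set.range fun i => FreeGroup.mk (w i)) = ⊤) :
    HasLoopGraph w 2 := by
  have key : ∀ m, 2 ≤ m → HasLoopGraph w m → HasLoopGraph w 2 := by
    intro m hm
    induction m, hm using Nat.le_induction with
    | base => exact id
    | succ m hm ih => exact fun h => ih (h.fold (by omega) hw)
  refine key _ ?_ (hasLoopGraph_wedge hne)
  obtain ⟨i, hi⟩ := hlong
  have := Finset.single_le_sum (f := fun i => (w i).length - 1) (fun _ _ => Nat.zero_le _)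
    (Finset.mem_univ i)
  omega

/-- The label `a` of a fold and the set `A` of labels of edges that end at the vertex `true`: in a
graph with the vertices `true` and `false`, an edge from `s` to `t` with label `x` satisfies this
condition if the only fold involves two edges labelled `a`, from `false` to `false` and to
`true`. -/
def Crosses (φ : WhiteheadDatum r) (s : Bool) (x : Letter r) (t : Bool) : Prop :=
  (x ≠ φ.1.1 → (t = true ↔ x ∈ φ.1.2)) ∧ (x.inv ≠ φ.1.1 → (s = true ↔ x.inv ∈ φ.1.2))

/-- The edge labelled `a` from `false` to `true`, in one of its directions. -/
def IsFoldEdge (φ : WhiteheadDatum r) (s : Bool) (x : Letter r) (t : Bool) : Prop :=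
  (x = φ.1.1 ∧ t = true) ∨ (x.inv = φ.1.1 ∧ s = true)

/-- The graph before the last fold: if the elements `w i` generate the free group, then they are
represented by loops in a graph with two vertices, which becomes the rose by a single fold. -/
theorem exists_two_vertex_graph [NeZero r] (hne : ∀ i, w i ≠ [])
    (hlong : ∃ i, 2 ≤ (w i).length)
    (hw : Subgroup.closure (Set.range fun i => FreeGroup.mk (w i)) = ⊤) :
    ∃ (φ : WhiteheadDatum r) (T : Fin r → ℕ → Bool) (v₀ : Bool),
      (∀ i, T i 0 = v₀) ∧ (∀ i, T i (w i).length = v₀) ∧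
      (∀ i k, ∀ hk : k < (w i).length, Crosses φ (T i k) (w i)[k] (T i (k + 1))) ∧
      ∃ i k, ∃ hk : k < (w i).length, IsFoldEdge φ (T i k) (w i)[k] (T i (k + 1)) := by
  classical
  obtain ⟨V, _, _, T, v₀, hT, hV, hcard⟩ := hasLoopGraph_two hne hlong hw
  have : Nontrivial V := Fintype.one_lt_card_iff_nontrivial.1 (by omega)
  obtain ⟨u, a, v, v', he, he', hvv'⟩ := hT.exists_fold hw
  set E := traceEdges w T with hE
  have htwo : ∀ x y z : V, x ≠ y → z = x ∨ z = y := by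
    intro x y z hxy
    by_contra! hz
    have : ({x, y, z} : Finset V).card ≤ 2 := hV ▸ Finset.card_le_univ _
    rw [Finset.card_eq_three.2 ⟨x, y, z, hxy, hz.1.symm, hz.2.symm, rfl⟩] at this
    omega
  -- With only two vertices, one of the folded edges is a loop at `u` and the other one leads to the
  -- other vertex.
  obtain ⟨v₂, hv₂, huu, huv⟩ : ∃ v₂, v₂ ≠ u ∧ posEdge u a u ∈ E ∧ posEdge u a v₂ ∈ E := by
    rcases htwo v v' u hvv' with rfl | rfl
    · exact ⟨v', hvv'.symm, he, he'⟩
    · exact ⟨v, hvv', he', he⟩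
  let F : Fin r → Finset (V × Fin r × V) := fun j => E.filter fun e => e.2.1 = j
  have hsum : ∑ j, (F j).card ≤ r + 1 := by
    rw [← Finset.card_eq_sum_card_fiberwise (f := fun e : V × Fin r × V => e.2.1)
      (t := Finset.univ) (fun _ _ => Finset.mem_coe.2 (Finset.mem_univ _))]
    omega
  have hone : ∀ j, 1 ≤ (F j).card := fun j => by
    obtain ⟨e, he, hej⟩ := hT.exists_label hw j
    exact Finset.card_pos.2 ⟨e, Finset.mem_filter.2 ⟨he, hej⟩⟩
  have hpair : ({posEdge u a u, posEdge u a v₂} : Finset _) ⊆ F a.1 := by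
    intro e
    simp only [Finset.mem_insert, Finset.mem_singleton, F, Finset.mem_filter]
    rintro (rfl | rfl)
    · exact ⟨huu, posEdge_label _ _ _⟩
    · exact ⟨huv, posEdge_label _ _ _⟩
  have hpair_card : ({posEdge u a u, posEdge u a v₂} : Finset (V × Fin r × V)).card = 2 :=
    Finset.card_pair fun h => hv₂ (posEdge_inj.1 h).2.symm
  -- The excess over one edge per label is at most one in total. This formula says that the label of
  -- `a` has at most two edges, and that it has at most three together with any other label.
  have hle : ∀ j, (F j).card + (if j = a.1 then 0 else (F a.1).card) ≤
      2 + (if j = a.1 then 0 else 1) := by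
    intro j
    have h2 : ∑ j, ((F j).card - 1) + r = ∑ j, (F j).card := by
      have : ∀ j, (F j).card = ((F j).card - 1) + 1 := fun j => by have := hone j; omega
      rw [Finset.sum_congr rfl (fun j _ => this j), Finset.sum_add_distrib]
      simp
    have h3 : ∑ j, ((F j).card - 1) ≤ 1 := by omega
    by_cases hj : j = a.1
    · have := Finset.single_le_sum (f := fun j => (F j).card - 1) (fun _ _ => Nat.zero_le _)
        (Finset.mem_univ j)
      simp only [hj, if_true] at this ⊢
      omega
    · have := Finset.sum_le_sum_of_subset (f := fun j => (F j).card - 1)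
        (Finset.subset_univ {j, a.1})
      rw [Finset.sum_pair hj] at this
      simp only [hj, if_false]
      have := hone j
      have := hone a.1
      omega
  have hF : F a.1 = {posEdge u a u, posEdge u a v₂} := by
    refine (Finset.eq_of_subset_of_card_le hpair ?_).symm
    have := hle a.1
    simp only [if_true] at this
    omega
  have huniq : ∀ j ≠ a.1, (F j).card ≤ 1 := by
    intro j hj
    have h1 := hle j
    rw [hF, hpair_card] at h1
    simp only [hj, if_false] at h1
    omega
  have ha : ∀ s t, posEdge s a t ∈ E → s = u := by
    intro s t hst
    have : posEdge s a t ∈ F a.1 := Finset.mem_filter.2 ⟨hst, posEdge_label _ _ _⟩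
    rw [hF, Finset.mem_insert, Finset.mem_singleton, posEdge_inj, posEdge_inj] at this
    tauto
  let A : Finset (Letter r) := Finset.univ.filter fun x => ∃ s, posEdge s x v₂ ∈ E
  have hA : ∀ x, x ∈ A ↔ ∃ s, posEdge s x v₂ ∈ E := fun x => by simp [A]
  -- Both edges labelled `a` start at `u`, so reading `a⁻¹` never ends at `v₂`.
  have haA : a.inv ∉ A := by
    rw [hA]
    rintro ⟨s, hs⟩
    rw [posEdge_inv] at hs
    exact hv₂ (ha _ _ hs)
  let φ : WhiteheadDatum r := ⟨(a, A), (hA a).2 ⟨u, huv⟩, haA⟩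
  have hend : ∀ s x t, posEdge s x t ∈ E → x ≠ a → (t = v₂ ↔ x ∈ A) := by
    intro s x t hst hx
    refine ⟨fun h => (hA x).2 ⟨s, h ▸ hst⟩, fun h => ?_⟩
    by_cases hxa : x.1 = a.1
    · rcases Letter.eq_or_eq_inv hxa with rfl | rfl
      · exact absurd rfl hx
      · exact absurd h haA
    · obtain ⟨s', hs'⟩ := (hA x).1 h
      have := Finset.card_le_one.1 (huniq _ hxa) _
        (Finset.mem_filter.2 ⟨hst, posEdge_label _ _ _⟩) _
        (Finset.mem_filter.2 ⟨hs', posEdge_label _ _ _⟩)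
      exact (posEdge_inj.1 this).2
  -- The vertex `v₂` becomes `true`, and `u` becomes `false`.
  refine ⟨φ, fun i k => decide (T i k = v₂), decide (v₀ = v₂), fun i => by simp [hT.start],
    fun i => by simp [hT.finish], fun i k hk => ?_, ?_⟩
  · have hm := posEdge_mem_traceEdges (w := w) (T := T) i hk
    refine ⟨fun h => ?_, fun h => ?_⟩
    · rw [decide_eq_true_iff]
      exact hend _ _ _ hm h
    · rw [decide_eq_true_iff]
      exact hend _ _ _ (by rwa [posEdge_inv]) h
  · obtain ⟨⟨i, k, hk⟩, -, hik⟩ := Finset.mem_image.1 huv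
    refine ⟨i, k, hk, ?_⟩
    have hlab := congrArg (fun e => e.2.1) hik
    simp only [posEdge_label] at hlab
    rcases Letter.eq_or_eq_inv hlab with h | h
    · left
      refine ⟨h, ?_⟩
      simp only [Fin.getElem_fin] at h hik
      rw [h, posEdge_inj] at hik
      simpa using hik.2
    · right
      simp only [Fin.getElem_fin] at h hik
      rw [h, posEdge_inv, posEdge_inj] at hik
      exact ⟨by rw [h, Letter.inv_inv], by simpa using hik.2⟩

end Folding

/-! ### Whitehead automorphisms and primitive elements -/

namespace WhiteheadDatum

variable {r : ℕ}

/-- The data of the inverse automorphism. -/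
def symm (φ : WhiteheadDatum r) : WhiteheadDatum r :=
  ⟨(φ.1.1.inv, insert φ.1.1.inv (φ.1.2.erase φ.1.1)), Finset.mem_insert_self _ _, by
    rw [Letter.inv_inv, Finset.mem_insert, not_or]
    exact ⟨(Letter.inv_ne _).symm, Finset.notMem_erase _ _⟩⟩

theorem symm_symm (φ : WhiteheadDatum r) : φ.symm.symm = φ := by
  obtain ⟨⟨a, A⟩, ha, ha'⟩ := φ
  refine Subtype.ext (Prod.ext (Letter.inv_inv a) ?_)
  simp only [symm, Letter.inv_inv] at ha ha' ⊢
  rw [Finset.erase_insert (fun h => ha' (Finset.mem_of_mem_erase h)), Finset.insert_erase ha]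

theorem symm_tail_mul_tail (φ : WhiteheadDatum r) {x : Letter r} (hx : x.1 ≠ φ.1.1.1) :
    φ.symm.tail x * φ.tail x = 1 := by
  have h1 : x ≠ φ.1.1 := fun h => hx (by rw [h])
  have h2 : x ≠ φ.1.1.inv := fun h => hx (by rw [h]; rfl)
  have h3 : (x ∈ φ.symm.1.2) ↔ x ∈ φ.1.2 := by simp [symm, h1, h2]
  unfold tail
  simp only [h3]
  split_ifs
  · exact (congrArg (· * _) (mk_inv φ.1.1)).trans (inv_mul_cancel _)
  · exact mul_one 1

theorem symm_hom_tail (φ : WhiteheadDatum r) (x : Letter r) :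
    φ.symm.hom (φ.tail x) = φ.tail x := by
  have : φ.symm.hom (FreeGroup.mk [φ.1.1]) = FreeGroup.mk [φ.1.1] := by
    have h := hom_letter φ.symm φ.1.1
    have h1 : φ.symm.tail φ.1.1.inv = FreeGroup.mk [φ.1.1.inv] :=
      if_pos (Finset.mem_insert_self _ _)
    have h2 : φ.symm.tail φ.1.1 = 1 := by
      refine if_neg ?_
      have := φ.symm.2.2
      rwa [show φ.symm.1.1.inv = φ.1.1 from Letter.inv_inv _] at this
    have h3 : φ.symm.keep φ.1.1 = none := if_pos rfl
    rw [h, h1, h2, h3, mk_inv]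
    simp [← FreeGroup.one_eq_mk]
  unfold tail
  split_ifs
  · exact this
  · exact map_one _

/-- The multiplier `a` is fixed by both maps, and the inverse datum attaches `a⁻¹` exactly where the
original attaches `a`, so the factors cancel. -/
theorem symm_hom_comp_hom (φ : WhiteheadDatum r) :
    φ.symm.hom.comp φ.hom = MonoidHom.id _ := by
  ext i
  by_cases hi : i = φ.1.1.1
  · have h' : i = φ.symm.1.1.1 := hi
    have h1 : φ.hom (FreeGroup.of i) = FreeGroup.of i := by
      rw [hom, FreeGroup.lift_apply_of, if_pos hi]
    have h2 : φ.symm.hom (FreeGroup.of i) = FreeGroup.of i := by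
      rw [hom, FreeGroup.lift_apply_of, if_pos h']
    rw [MonoidHom.comp_apply, h1, h2, MonoidHom.id_apply]
  · have h' : i ≠ φ.symm.1.1.1 := hi
    have h1 : φ.hom (FreeGroup.of i) =
        (φ.tail (i, false))⁻¹ * FreeGroup.of i * φ.tail (i, true) := by simp [hom, hi]
    have h2 : φ.symm.hom (FreeGroup.of i) =
        (φ.symm.tail (i, false))⁻¹ * FreeGroup.of i * φ.symm.tail (i, true) := by simp [hom, h']
    rw [MonoidHom.comp_apply, h1, map_mul, map_mul, map_inv, symm_hom_tail, symm_hom_tail, h2]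
    have h3 := φ.symm_tail_mul_tail (x := (i, true)) hi
    have h4 := φ.symm_tail_mul_tail (x := (i, false)) hi
    rw [mul_eq_one_iff_eq_inv] at h3 h4
    rw [h3, h4, MonoidHom.id_apply]
    group

/-- A Whitehead automorphism is an automorphism. -/
def equiv (φ : WhiteheadDatum r) : FreeGroup (Fin r) ≃* FreeGroup (Fin r) :=
  MonoidHom.toMulEquiv φ.hom φ.symm.hom φ.symm_hom_comp_hom (by
    have := φ.symm.symm_hom_comp_hom
    rwa [symm_symm] at this)

theorem equiv_apply (φ : WhiteheadDatum r) (g : FreeGroup (Fin r)) : φ.equiv g = φ.hom g := rfl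

end WhiteheadDatum

/-! ### Invariance of primitivity -/

section Primitive

variable {r : ℕ} [NeZero r]

theorem isPrimitive_apply_iff (ψ : FreeGroup (Fin r) ≃* FreeGroup (Fin r))
    (g : FreeGroup (Fin r)) : IsPrimitive (ψ g) ↔ IsPrimitive g := by
  constructor
  · rintro ⟨χ, hχ⟩
    exact ⟨χ.trans ψ.symm, by simp [hχ]⟩
  · rintro ⟨χ, rfl⟩
    exact ⟨χ.trans ψ, rfl⟩

theorem isPrimitive_conj_iff (g h : FreeGroup (Fin r)) :
    IsPrimitive (g * h * g⁻¹) ↔ IsPrimitive h := by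
  rw [← isPrimitive_apply_iff (MulAut.conj g) h, MulAut.conj_apply]

theorem isPrimitive_mk_image_iff (φ : WhiteheadDatum r) (x : Letter r) (l : List (Letter r)) :
    IsPrimitive (FreeGroup.mk (φ.image x x l)) ↔ IsPrimitive (FreeGroup.mk (x :: l)) := by
  rw [WhiteheadDatum.mk_image, isPrimitive_conj_iff, ← WhiteheadDatum.equiv_apply,
    isPrimitive_apply_iff]

theorem not_isPrimitive_one : ¬ IsPrimitive (1 : FreeGroup (Fin r)) := by
  rintro ⟨χ, hχ⟩
  rw [map_eq_one_iff χ χ.injective] at hχ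
  exact FreeGroup.of_ne_one _ hχ

theorem isPrimitive_letter (x : Letter r) : IsPrimitive (FreeGroup.mk [x]) := by
  have key : ∀ i : Fin r, IsPrimitive (FreeGroup.of i) := fun i =>
    ⟨FreeGroup.freeGroupCongr (Equiv.swap 0 i), by simp⟩
  obtain ⟨i, _ | _⟩ := x
  -- Inverse letters are reached by the automorphism that inverts all generators.
  · have hinv : Function.Involutive
        (FreeGroup.lift fun j : Fin r => (FreeGroup.of j)⁻¹ : FreeGroup (Fin r) →* _) := by
      intro g
      rw [← MonoidHom.comp_apply]
      refine DFunLike.congr_fun (g := MonoidHom.id _) ?_ g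
      ext j
      simp
    let ι : FreeGroup (Fin r) ≃* FreeGroup (Fin r) :=
      { (hinv.toPerm) with map_mul' := fun a b => map_mul _ a b }
    have : ι (FreeGroup.of i) = FreeGroup.mk [(i, false)] := by
      change FreeGroup.lift (fun j : Fin r => (FreeGroup.of j)⁻¹) (FreeGroup.of i) = _
      rw [FreeGroup.lift_apply_of]
      exact (WhiteheadDatum.mk_inv (i, true)).symm
    rw [← this, isPrimitive_apply_iff]
    exact key i
  · exact key i

end Primitive

/-! ### Contracting the joining edge and the length of cyclic images -/

namespace Folding

variable {r : ℕ}

open Classical in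
/-- Delete the letters that belong to fold edges, along the path with vertices `t`. -/
noncomputable def dropFold (φ : WhiteheadDatum r) : (ℕ → Bool) → List (Letter r) → List (Letter r)
  | _, [] => []
  | t, x :: l =>
    (if IsFoldEdge φ (t 0) x (t 1) then [] else [x]) ++ dropFold φ (fun k => t (k + 1)) l

/-- The consecutive letters of `l` can be read along the path with vertices `t`. -/
def Follows (φ : WhiteheadDatum r) (t : ℕ → Bool) (l : List (Letter r)) : Prop :=
  ∀ k, ∀ hk : k < l.length, Crosses φ (t k) l[k] (t (k + 1))

theorem Follows.head {φ : WhiteheadDatum r} {t : ℕ → Bool} {x : Letter r} {l : List (Letter r)}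
    (h : Follows φ t (x :: l)) : Crosses φ (t 0) x (t 1) := h 0 (by simp)

theorem Follows.tail {φ : WhiteheadDatum r} {t : ℕ → Bool} {x : Letter r} {l : List (Letter r)}
    (h : Follows φ t (x :: l)) : Follows φ (fun k => t (k + 1)) l :=
  fun k hk => h (k + 1) (by simpa using hk)

/-- The vertex `false` is represented by `1` and the vertex `true` by `a`. -/
def vertexElt (φ : WhiteheadDatum r) (s : Bool) : FreeGroup (Fin r) :=
  if s then FreeGroup.mk [φ.1.1] else 1

-- This is contraction of the joining edge: with `1` and `a` attached to its two ends, the label `a`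
-- of that edge is absorbed entirely, while every other edge keeps its label.
open Classical in
theorem Crosses.hom_eq {φ : WhiteheadDatum r} {s t : Bool} {x : Letter r} (h : Crosses φ s x t) :
    φ.hom (FreeGroup.mk [x]) = (vertexElt φ s)⁻¹ *
      FreeGroup.mk (if IsFoldEdge φ s x t then [] else [x]) * vertexElt φ t := by
  rw [WhiteheadDatum.hom_letter]
  obtain ⟨h1, h2⟩ := h
  have ha := φ.2.1
  have ha' := φ.2.2
  by_cases hx : x = φ.1.1
  · have hxi : x.inv ≠ φ.1.1 := hx ▸ Letter.inv_ne x
    have hs := h2 hxi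
    rw [hx] at hs hxi
    simp only [ha', iff_false, Bool.not_eq_true] at hs
    cases t <;>
      simp [hx, hs, hxi, WhiteheadDatum.tail, WhiteheadDatum.keep, ha, ha', vertexElt, IsFoldEdge,
        ← FreeGroup.one_eq_mk]
  · by_cases hxi : x.inv = φ.1.1
    · have ht := h1 hx
      have hx' : x = φ.1.1.inv := by rw [← hxi, Letter.inv_inv]
      rw [hx'] at ht hx
      simp only [ha', iff_false, Bool.not_eq_true] at ht
      cases s <;>
        simp [hx', hx, ht, Letter.inv_inv, WhiteheadDatum.tail, WhiteheadDatum.keep, ha, ha',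
          vertexElt, IsFoldEdge, ← FreeGroup.one_eq_mk, WhiteheadDatum.mk_inv,
          show (φ.1.1.inv).1 = φ.1.1.1 from rfl]
    · have hk : x.1 ≠ φ.1.1.1 := fun h => by
        rcases Letter.eq_or_eq_inv h with h | h
        · exact hx h
        · exact hxi (by rw [h, Letter.inv_inv])
      have h1 := h1 hx
      have h2 := h2 hxi
      cases s <;> cases t <;> simp at h1 h2 <;>
        simp [hx, hxi, hk, h1, h2, WhiteheadDatum.tail, WhiteheadDatum.keep, vertexElt, IsFoldEdge]

/-- The vertex factors telescope along the path, so for a closed path only a conjugation by the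
factor of the base point remains. -/
theorem Follows.hom_eq {φ : WhiteheadDatum r} {t : ℕ → Bool} {l : List (Letter r)}
    (h : Follows φ t l) :
    φ.hom (FreeGroup.mk l) =
      (vertexElt φ (t 0))⁻¹ * FreeGroup.mk (dropFold φ t l) * vertexElt φ (t l.length) := by
  induction l generalizing t with
  | nil => simp [dropFold, ← FreeGroup.one_eq_mk]
  | cons x l ih =>
    have h5 : FreeGroup.mk (x :: l) = FreeGroup.mk [x] * FreeGroup.mk l := by
      rw [FreeGroup.mul_mk]; rfl
    rw [h5, map_mul, ih h.tail, h.head.hom_eq, dropFold, ← FreeGroup.mul_mk]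
    simp only [List.length_cons, zero_add]
    group

theorem dropFold_length_le (φ : WhiteheadDatum r) (t : ℕ → Bool) (l : List (Letter r)) :
    (dropFold φ t l).length ≤ l.length := by
  induction l generalizing t with
  | nil => simp [dropFold]
  | cons x l ih =>
    have := ih fun k => t (k + 1)
    rw [dropFold]
    split_ifs <;> simp <;> omega

theorem dropFold_length_lt (φ : WhiteheadDatum r) (t : ℕ → Bool) (l : List (Letter r)) {k : ℕ}
    (hk : k < l.length) (h : IsFoldEdge φ (t k) l[k] (t (k + 1))) :
    (dropFold φ t l).length < l.length := by
  induction l generalizing t k with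
  | nil => simp at hk
  | cons x l ih =>
    rw [dropFold]
    cases k with
    | zero =>
      have := dropFold_length_le φ (fun k => t (k + 1)) l
      rw [if_pos (by simpa using h)]
      simp
      omega
    | succ k =>
      have := ih (fun k => t (k + 1)) (k := k) (by simpa using hk) (by simpa using h)
      split_ifs <;> simp <;> omega

theorem dropFold_eq_self (φ : WhiteheadDatum r) (t : ℕ → Bool) (l : List (Letter r))
    (h : ∀ k, ∀ hk : k < l.length, ¬ IsFoldEdge φ (t k) l[k] (t (k + 1))) :
    dropFold φ t l = l := by
  induction l generalizing t with
  | nil => rfl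
  | cons x l ih =>
    have h0 : ¬ IsFoldEdge φ (t 0) x (t 1) := h 0 (by simp)
    rw [dropFold, if_neg h0,
      ih _ (fun k hk => h (k + 1) (by simpa using hk))]
    rfl

-- An amortised count: `glue` writes the `a⁻¹` of a loop edge at `false` one letter early, and the
-- conditional summands book this advance. Every other letter written is charged to the letter just
-- read, and the joining edge contributes nothing.
open Classical in
theorem image_step_length_le {φ : WhiteheadDatum r} {s t : Bool} {x y : Letter r}
    (hx : Crosses φ s x t) (hy : y.inv ≠ φ.1.1 → (t = true ↔ y.inv ∈ φ.1.2)) :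
    (φ.keep x).toList.length + (φ.glue x y).toList.length +
        (if x.inv = φ.1.1 ∧ s = false then 1 else 0) ≤
      (if IsFoldEdge φ s x t then [] else [x]).length +
        (if y.inv = φ.1.1 ∧ t = false then 1 else 0) := by
  obtain ⟨h1, h2⟩ := hx
  have ha := φ.2.1
  have ha' := φ.2.2
  by_cases hx : x = φ.1.1
  · have hxi : x.inv ≠ φ.1.1 := hx ▸ Letter.inv_ne x
    rw [hx] at hxi
    by_cases hyi : y.inv = φ.1.1
    · simp [hx, hxi, hyi, WhiteheadDatum.glue, WhiteheadDatum.keep, ha]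
    · have hy := hy hyi
      cases t <;> simp at hy <;>
        simp [hx, hxi, hyi, hy, WhiteheadDatum.glue, WhiteheadDatum.keep, ha, IsFoldEdge]
  · have h1 := h1 hx
    by_cases hxi : x.inv = φ.1.1
    · have hx' : x = φ.1.1.inv := by rw [← hxi, Letter.inv_inv]
      rw [hx'] at h1 hx
      simp only [ha', iff_false, Bool.not_eq_true] at h1
      by_cases hyi : y.inv = φ.1.1
      · cases s <;> simp [hx', h1, hyi, hx, WhiteheadDatum.glue, WhiteheadDatum.keep, ha, ha',
          IsFoldEdge, Letter.inv_inv, show (φ.1.1.inv).1 = φ.1.1.1 from rfl]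
      · have hy := hy hyi
        rw [h1] at hy
        simp at hy
        cases s <;> simp [hx', h1, hyi, hy, hx, WhiteheadDatum.glue, WhiteheadDatum.keep,
          ha', IsFoldEdge, Letter.inv_inv, show (φ.1.1.inv).1 = φ.1.1.1 from rfl]
    · have hk : x.1 ≠ φ.1.1.1 := fun h => by
        rcases Letter.eq_or_eq_inv h with h | h
        · exact hx h
        · exact hxi (by rw [h, Letter.inv_inv])
      by_cases hyi : y.inv = φ.1.1
      · cases t <;> simp at h1 <;>
          simp [hx, hxi, hk, hyi, h1, ha, WhiteheadDatum.glue, WhiteheadDatum.keep, IsFoldEdge]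
      · have hy := hy hyi
        cases t <;> simp at h1 hy <;>
          simp [hx, hxi, hk, hyi, h1, hy, WhiteheadDatum.glue, WhiteheadDatum.keep, IsFoldEdge]

-- The advances telescope. On a closed path with `f = x` the remaining two are equal, so the cyclic
-- image is no longer than the word without its fold edges.
open Classical in
theorem image_length_le {φ : WhiteheadDatum r} {t : ℕ → Bool} {f x : Letter r}
    {l : List (Letter r)} (h : Follows φ t (x :: l))
    (hf : f.inv ≠ φ.1.1 → (t (l.length + 1) = true ↔ f.inv ∈ φ.1.2)) :
    (φ.image f x l).length + (if x.inv = φ.1.1 ∧ t 0 = false then 1 else 0) ≤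
      (dropFold φ t (x :: l)).length +
        (if f.inv = φ.1.1 ∧ t (l.length + 1) = false then 1 else 0) := by
  induction l generalizing t x with
  | nil =>
    have := image_step_length_le h.head hf
    simp only [WhiteheadDatum.image, dropFold, List.append_nil, List.length_append,
      List.length_nil, zero_add]
    exact this
  | cons y l ih =>
    have h1 := image_step_length_le h.head h.tail.head.2
    have h2 := ih h.tail hf
    rw [WhiteheadDatum.image, dropFold]
    simp only [List.length_append, List.length_cons, zero_add] at h1 h2 ⊢
    omega

/-- The image of a cyclic word that traverses the fold edge is shorter. -/
theorem image_length_lt {φ : WhiteheadDatum r} {t : ℕ → Bool} {x : Letter r}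
    {l : List (Letter r)} (h : Follows φ t (x :: l)) (ht : t (l.length + 1) = t 0) {k : ℕ}
    (hk : k < (x :: l).length) (hfold : IsFoldEdge φ (t k) (x :: l)[k] (t (k + 1))) :
    (φ.image x x l).length < (x :: l).length := by
  have h1 := image_length_le h (f := x) (by rw [ht]; exact h.head.2)
  rw [ht] at h1
  have h2 := dropFold_length_lt φ t _ hk hfold
  omega

end Folding

/-! ### Shortening primitive words, and the cut vertex of their Whitehead graph -/

section Reduction

open Folding

variable {r : ℕ} [NeZero r]

/-- Reduced words for the images of the generators, where the word for the first one is given. -/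
def basisWords (χ : FreeGroup (Fin r) ≃* FreeGroup (Fin r)) (l : List (Letter r)) (i : Fin r) :
    List (Letter r) :=
  if i = 0 then l else (χ (FreeGroup.of i)).toWord

theorem mk_basisWords {χ : FreeGroup (Fin r) ≃* FreeGroup (Fin r)} {l : List (Letter r)}
    (h : χ (FreeGroup.of 0) = FreeGroup.mk l) (i : Fin r) :
    FreeGroup.mk (basisWords χ l i) = χ (FreeGroup.of i) := by
  rw [basisWords]
  split_ifs with hi
  · rw [hi, h]
  · exact FreeGroup.mk_toWord

/-- The word `l` need not be reduced, so the Whitehead algorithm can use the images as they are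
written, without checking that they are cyclically reduced. -/
theorem exists_two_vertex_graph_of_basis {χ : FreeGroup (Fin r) ≃* FreeGroup (Fin r)}
    {l : List (Letter r)} (h : χ (FreeGroup.of 0) = FreeGroup.mk l) (hl : 2 ≤ l.length) :
    ∃ (φ : WhiteheadDatum r) (T : Fin r → ℕ → Bool) (v₀ : Bool),
      (∀ i, T i 0 = v₀) ∧ (∀ i, T i (basisWords χ l i).length = v₀) ∧
      (∀ i, Follows φ (T i) (basisWords χ l i)) ∧
      ∃ i k, ∃ hk : k < (basisWords χ l i).length,
        IsFoldEdge φ (T i k) (basisWords χ l i)[k] (T i (k + 1)) := by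
  refine exists_two_vertex_graph (w := basisWords χ l) (fun i hi => ?_)
    ⟨0, by rwa [basisWords, if_pos rfl]⟩ ?_
  · have := mk_basisWords h i
    rw [hi, ← FreeGroup.one_eq_mk, eq_comm, map_eq_one_iff χ χ.injective] at this
    exact FreeGroup.of_ne_one _ this
  · have : (fun i => FreeGroup.mk (basisWords χ l i)) = χ ∘ FreeGroup.of :=
      funext fun i => mk_basisWords h i
    rw [this, Set.range_comp]
    have h1 := MonoidHom.map_closure (χ : FreeGroup (Fin r) →* FreeGroup (Fin r))
      (Set.range FreeGroup.of)
    rw [FreeGroup.closure_range_of] at h1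
    rw [MonoidHom.coe_coe] at h1
    rw [← h1]
    exact Subgroup.map_top_of_surjective _ χ.surjective

/-- A word of length at least two that represents a primitive element is made shorter by some
Whitehead automorphism. -/
theorem exists_image_length_lt {x : Letter r} {l : List (Letter r)} (hl : l ≠ [])
    (h : IsPrimitive (FreeGroup.mk (x :: l))) :
    ∃ φ : WhiteheadDatum r, (φ.image x x l).length < (x :: l).length := by
  classical
  -- The quantity minimised over all bases with the prescribed first member: the total length of the
  -- other members.
  let size : (FreeGroup (Fin r) ≃* FreeGroup (Fin r)) → ℕ := fun χ =>
    ∑ i ∈ Finset.univ.erase 0, (χ (FreeGroup.of i)).norm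
  obtain ⟨χ, hχ, hmin⟩ : ∃ χ : FreeGroup (Fin r) ≃* FreeGroup (Fin r),
      χ (FreeGroup.of 0) = FreeGroup.mk (x :: l) ∧
        ∀ χ' : FreeGroup (Fin r) ≃* FreeGroup (Fin r),
          χ' (FreeGroup.of 0) = FreeGroup.mk (x :: l) → size χ ≤ size χ' := by
    have hex : ∃ n, ∃ χ : FreeGroup (Fin r) ≃* FreeGroup (Fin r),
        χ (FreeGroup.of 0) = FreeGroup.mk (x :: l) ∧ size χ = n := by
      obtain ⟨χ, hχ⟩ := h
      exact ⟨_, χ, hχ, rfl⟩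
    obtain ⟨χ, hχ, hn⟩ := Nat.find_spec hex
    exact ⟨χ, hχ, fun χ' hχ' => hn ▸ Nat.find_min' hex ⟨χ', hχ', rfl⟩⟩
  have hlen : 2 ≤ (x :: l).length := by
    have := List.length_pos_iff.2 hl
    simp
    omega
  obtain ⟨φ, T, v₀, hstart, hfinish, hT, i, k, hk, hfold⟩ :=
    exists_two_vertex_graph_of_basis hχ hlen
  have h0 : basisWords χ (x :: l) 0 = x :: l := if_pos rfl
  refine ⟨φ, ?_⟩
  by_cases hex : ∃ k, ∃ hk : k < (x :: l).length,
      IsFoldEdge φ (T 0 k) (x :: l)[k] (T 0 (k + 1))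
  · obtain ⟨k, hk, hfold⟩ := hex
    have hT0 := hT 0
    have hf0 := hfinish 0
    rw [h0] at hT0 hf0
    exact image_length_lt hT0 (by rw [hstart]; exact hf0) hk hfold
  -- If the word avoids the fold edge, the automorphism followed by a conjugation preserves it and
  -- shortens another basis word that uses the fold edge, against minimality.
  · push Not at hex
    exfalso
    let χ' := (χ.trans φ.equiv).trans (MulAut.conj (vertexElt φ v₀))
    have hχ' : ∀ i, χ' (FreeGroup.of i) =
        FreeGroup.mk (dropFold φ (T i) (basisWords χ (x :: l) i)) := by
      intro i
      have := (hT i).hom_eq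
      rw [hstart, hfinish, mk_basisWords hχ] at this
      simp only [χ', MulEquiv.trans_apply, MulAut.conj_apply, WhiteheadDatum.equiv_apply, this]
      group
    have hχ'0 : χ' (FreeGroup.of 0) = FreeGroup.mk (x :: l) := by
      rw [hχ', h0, dropFold_eq_self _ _ _ hex]
    have hi : i ≠ 0 := by
      rintro rfl
      simp only [h0] at hk hfold
      exact hex k hk hfold
    have hword : ∀ j ∈ Finset.univ.erase (0 : Fin r),
        (χ (FreeGroup.of j)).norm = (basisWords χ (x :: l) j).length := by
      intro j hj
      rw [basisWords, if_neg (Finset.ne_of_mem_erase hj)]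
      rfl
    refine absurd (hmin χ' hχ'0) (not_le.2 ?_)
    refine Finset.sum_lt_sum (fun j hj => ?_) ⟨i, by simp [hi], ?_⟩
    · rw [hword j hj, hχ']
      exact FreeGroup.norm_mk_le.trans (dropFold_length_le _ _ _)
    · rw [hword i (by simp [hi]), hχ']
      exact FreeGroup.norm_mk_le.trans_lt (dropFold_length_lt _ _ _ hk hfold)

/-- The Whitehead graph of a cyclically reduced primitive word is not complete. -/
theorem exists_missing_edge {u : List (Letter r)} (hu : FreeGroup.IsCyclicallyReduced u)
    (hlen : 2 ≤ u.length) (h : IsPrimitive (FreeGroup.mk u)) :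
    ∃ p q : Letter r, p ≠ q ∧ ∀ k, ∀ hk : k + 1 < u.length, s(p, q) ≠ s(u[k], u[k + 1].inv) := by
  obtain ⟨χ, hχ⟩ := h
  obtain ⟨φ, T, v₀, hstart, hfinish, hT, i, k, hk, hfold⟩ :=
    exists_two_vertex_graph_of_basis hχ hlen
  have h0 : basisWords χ u 0 = u := if_pos rfl
  have ha' := φ.2.2
  -- No basis word contains `a` followed by `a⁻¹`.
  have hred : ∀ i k, ∀ hk : k + 1 < (basisWords χ u i).length,
      ¬ ((basisWords χ u i)[k] = φ.1.1 ∧ (basisWords χ u i)[k + 1].inv = φ.1.1) := by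
    rintro i k hk ⟨h1, h2⟩
    have hr : FreeGroup.IsReduced (basisWords χ u i) := by
      rw [basisWords]
      split_ifs
      · exact hu.isReduced
      · exact FreeGroup.isReduced_toWord
    have := List.isChain_iff_getElem.1 hr k hk
    rw [h1, ← h2] at this
    simp [Letter.inv] at this
  -- If `A = {a}`, the vertex `true` can only be entered by `a` and left by `a⁻¹`. With base point
  -- `true`, the word `u` would begin with `a⁻¹` and end with `a`; with base point `false`, the loop
  -- through the fold edge would backtrack.
  obtain ⟨q, hq, hqa⟩ : ∃ q ∈ φ.1.2, q ≠ φ.1.1 := by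
    by_contra! hA
    have hprev : ∀ i k, ∀ hk : k < (basisWords χ u i).length, T i (k + 1) = true →
        (basisWords χ u i)[k] = φ.1.1 := fun i k hk ht => by
      by_contra hne
      exact hne (hA _ (((hT i k hk).1 hne).1 ht))
    have hnext : ∀ i k, ∀ hk : k < (basisWords χ u i).length, T i k = true →
        (basisWords χ u i)[k].inv = φ.1.1 := fun i k hk ht => by
      by_contra hne
      exact hne (hA _ (((hT i k hk).2 hne).1 ht))
    cases v₀ with
    | true =>
      have h1 := hnext 0 0 (by rw [h0]; omega) (hstart 0)
      have h2 := hprev 0 (u.length - 1) (by rw [h0]; omega) (by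
        have := hfinish 0
        rw [h0] at this
        rwa [Nat.sub_add_cancel (by omega)])
      simp only [h0] at h1 h2
      have := hu.2 u[u.length - 1] (by rw [List.getLast?_eq_getElem?]; simp) u[0]
        (by rw [List.head?_eq_getElem?]; simp)
      rw [h2, ← h1] at this
      simp [Letter.inv] at this
    | false =>
      rcases hfold with ⟨h1, h2⟩ | ⟨h1, h2⟩
      · have hk' : k + 1 < (basisWords χ u i).length := by
          refine lt_of_le_of_ne hk fun heq => ?_
          have := hfinish i
          rw [← heq, h2] at this
          cases this
        exact hred i k hk' ⟨h1, hnext i _ hk' h2⟩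
      · cases k with
        | zero => rw [hstart] at h2; cases h2
        | succ k => exact hred i k hk ⟨hprev i k (by omega) h2, h1⟩
  -- Consecutive letters meet at one vertex, which would have to be `false` because of `a⁻¹` and
  -- `true` because of `q`.
  refine ⟨φ.1.1.inv, q, fun h => ha' (h ▸ hq), fun k hk heq => ?_⟩
  have hT0 := hT 0
  rw [h0] at hT0
  have h1 := (hT0 k (by omega)).1
  have h2 := (hT0 (k + 1) hk).2
  rcases Sym2.eq_iff.1 heq with ⟨e1, e2⟩ | ⟨e1, e2⟩
  · rw [← e1] at h1
    rw [← e2] at h2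
    exact ha' ((h1 (Letter.inv_ne _)).1 ((h2 hqa).2 hq))
  · rw [← e2] at h1
    rw [← e1] at h2
    exact ha' ((h2 (Letter.inv_ne _)).1 ((h1 hqa).2 hq))

end Reduction

/-! ### Runs of a machine -/

section Runs

variable {σ : Type} {step : σ → Bool ⊕ σ}

/-- The machine goes from `c` to `c'` in `t` steps. -/
def Runs (step : σ → Bool ⊕ σ) (t : ℕ) (c c' : σ) : Prop :=
  ∀ n, answerWithin step (n + t) c = answerWithin step n c'

theorem Runs.trans {t t' : ℕ} {c c' c'' : σ} (h : Runs step t c c') (h' : Runs step t' c' c'') :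
    Runs step (t' + t) c c'' := fun n => by
  rw [← add_assoc, h, h']

theorem Runs.single {c c' : σ} (h : step c = Sum.inr c') : Runs step 1 c c' := fun n => by
  rw [answerWithin, h]

theorem Runs.head {t : ℕ} {c c' c'' : σ} (h : step c = Sum.inr c') (h' : Runs step t c' c'') :
    Runs step (t + 1) c c'' :=
  (Runs.single h).trans h'

theorem Runs.cast {t t' : ℕ} {c c' : σ} (h : Runs step t c c') (ht : t = t') :
    Runs step t' c c' := ht ▸ h

theorem answerWithin_one {c : σ} {b : Bool} (h : step c = Sum.inl b) :
    answerWithin step 1 c = some b := by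
  rw [answerWithin, h]

theorem answerWithin_add {t : ℕ} {c : σ} {b : Bool} (h : answerWithin step t c = some b) (n : ℕ) :
    answerWithin step (t + n) c = some b := by
  induction t generalizing c with
  | zero => simp [answerWithin] at h
  | succ t ih =>
    rw [Nat.succ_add_eq_add_succ, Nat.add_succ]
    rw [answerWithin] at h ⊢
    cases hs : step c with
    | inl a => rw [hs] at h; exact h
    | inr c' => rw [hs] at h; exact ih h

theorem answerWithin_mono {t t' : ℕ} {c : σ} {b : Bool} (h : answerWithin step t c = some b)
    (ht : t ≤ t') : answerWithin step t' c = some b := by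
  obtain ⟨n, rfl⟩ := Nat.exists_eq_add_of_le ht
  exact answerWithin_add h n

theorem Runs.answerWithin {t n m : ℕ} {c c' : σ} {b : Bool} (h : Runs step t c c')
    (h' : answerWithin step n c' = some b) (hm : n + t ≤ m) : answerWithin step m c = some b :=
  answerWithin_mono ((h n).trans h') hm

theorem stepCount_le {t : ℕ} {c : σ} {b : Bool} (h : answerWithin step t c = some b) :
    stepCount step c ≤ t :=
  iInf₂_le t (by rw [h]; rfl)

end Runs

/-! ### Tapes that contain a word -/

namespace WordTape

open Turing

variable {r : ℕ}

/-- The tape with the word `L.reverse ++ R` and the head on the first letter of `R`, or behind the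
word. -/
def wt (L R : List (Letter r)) : Tape (Option (Letter r)) :=
  Tape.mk' (ListBlank.mk (L.map some)) (ListBlank.mk (R.map some))

/-- The tape with the word `L.reverse ++ R` and the head on the last letter of `L`, or in front of
the word. -/
def bt (L R : List (Letter r)) : Tape (Option (Letter r)) := (wt L R).move .left

/-- Trailing blanks are invisible, so an erased tape equals a fresh one. -/
theorem cons_none_mk_nil :
    ListBlank.cons none (ListBlank.mk ([] : List (Option (Letter r)))) = ListBlank.mk [] := by
  exact ListBlank.cons_head_tail (ListBlank.mk ([] : List (Option (Letter r))))

@[simp] theorem wt_head_nil (L : List (Letter r)) : (wt L []).head = none := rfl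

@[simp] theorem wt_head_cons (L R : List (Letter r)) (x : Letter r) :
    (wt L (x :: R)).head = some x := rfl

@[simp] theorem wt_move_right (L R : List (Letter r)) (x : Letter r) :
    (wt L (x :: R)).move .right = wt (x :: L) R := by
  rw [wt, Tape.move_right_mk']
  rfl

theorem bt_cons (L R : List (Letter r)) (x : Letter r) : bt (x :: L) R = wt L (x :: R) := by
  rw [bt, wt, Tape.move_left_mk']
  rfl

@[simp] theorem bt_head_nil (R : List (Letter r)) : (bt [] R).head = none := rfl

@[simp] theorem bt_head_cons (L R : List (Letter r)) (x : Letter r) :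
    (bt (x :: L) R).head = some x := rfl

@[simp] theorem bt_move_right (L R : List (Letter r)) : (bt L R).move .right = wt L R :=
  Tape.move_left_right _

@[simp] theorem bt_move_left (L R : List (Letter r)) (x : Letter r) :
    (bt (x :: L) R).move .left = bt L (x :: R) := by
  rw [bt_cons]
  rfl

@[simp] theorem wt_append (L : List (Letter r)) (x : Letter r) :
    ((wt L []).write (some x)).move .right = wt (x :: L) [] := by
  rw [wt, Tape.write_mk', Tape.move_right_mk']
  rfl

theorem wt_write_none (L : List (Letter r)) (x : Letter r) :
    (wt L [x]).write none = wt L [] := by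
  rw [wt, Tape.write_mk']
  change Tape.mk' _ (ListBlank.cons none (ListBlank.mk [])) = _
  rw [cons_none_mk_nil]
  rfl

@[simp] theorem bt_wipe (L : List (Letter r)) (x : Letter r) :
    ((bt (x :: L) []).write none).move .left = bt L [] := by
  rw [bt_cons, wt_write_none, bt]

@[simp] theorem wt_move_left (L R : List (Letter r)) : (wt L R).move .left = bt L R := rfl

@[simp] theorem wt_write_self_nil (L : List (Letter r)) : (wt L []).write none = wt L [] :=
  Tape.write_self (wt L [])

@[simp] theorem wt_write_self_cons (L R : List (Letter r)) (x : Letter r) :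
    (wt L (x :: R)).write (some x) = wt L (x :: R) :=
  Tape.write_self (wt L (x :: R))

@[simp] theorem bt_write_self_nil (R : List (Letter r)) : (bt [] R).write none = bt [] R :=
  Tape.write_self (bt [] R)

@[simp] theorem bt_write_self_cons (L R : List (Letter r)) (x : Letter r) :
    (bt (x :: L) R).write (some x) = bt (x :: L) R :=
  Tape.write_self (bt (x :: L) R)

theorem bt_nil_nil : bt ([] : List (Letter r)) [] = wt [] [] := by
  rw [bt, wt, Tape.move_left_mk']
  change Tape.mk' _ (ListBlank.cons none (ListBlank.mk [])) = _
  rw [List.map_nil, cons_none_mk_nil]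
  rfl

end WordTape

/-! ### The run of the algorithm -/

namespace AlgorithmA

open Turing WordTape

variable {r : ℕ}

/-- The tapes, given the input tape, the tape with the current word and the tape with its image. -/
def tapes (b : Bool) (T C I : Tape (Option (Letter r))) : Fin 3 → Tape (Option (Letter r)) :=
  Function.update (Function.update (fun _ => T) (curTape b) C) (imgTape b) I

theorem curTape_ne_imgTape (b : Bool) : curTape b ≠ imgTape b := by cases b <;> decide

@[simp] theorem tapes_cur (b : Bool) (T C I : Tape (Option (Letter r))) :
    tapes b T C I (curTape b) = C := by
  simp [tapes, curTape_ne_imgTape]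

@[simp] theorem tapes_img (b : Bool) (T C I : Tape (Option (Letter r))) :
    tapes b T C I (imgTape b) = I := by
  simp [tapes]

@[simp] theorem tapes_zero (b : Bool) (T C I : Tape (Option (Letter r))) :
    tapes b T C I 0 = T := by
  cases b <;> rfl

@[simp] theorem update_cur (b : Bool) (T C I C' : Tape (Option (Letter r))) :
    Function.update (tapes b T C I) (curTape b) C' = tapes b T C' I := by
  rw [tapes, Function.update_comm (curTape_ne_imgTape b).symm, Function.update_idem, tapes]

@[simp] theorem update_img (b : Bool) (T C I I' : Tape (Option (Letter r))) :
    Function.update (tapes b T C I) (imgTape b) I' = tapes b T C I' := by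
  rw [tapes, Function.update_idem, tapes]

@[simp] theorem update_zero (b : Bool) (T C I T' : Tape (Option (Letter r))) :
    Function.update (tapes b T C I) 0 T' = tapes b T' C I := by
  funext j
  cases b <;> fin_cases j <;> rfl

theorem tapes_not (b : Bool) (T C I : Tape (Option (Letter r))) :
    tapes (!b) T C I = tapes b T I C := by
  funext j
  cases b <;> fin_cases j <;> rfl

/-- The configurations of the algorithm. -/
abbrev Config (r : ℕ) : Type := AState r × (Fin 3 → Tape (Option (Letter r)))

/-- The result of the actions `act` on the tapes `tp`. -/
def applyActs (tp : Fin 3 → Tape (Option (Letter r))) (act : Fin 3 → Option (Letter r) × Option Dir)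
    (j : Fin 3) : Tape (Option (Letter r)) :=
  TuringMachine.applyAct (tp j) (act j)

@[simp] theorem applyActs_idle (tp : Fin 3 → Tape (Option (Letter r))) :
    applyActs tp (fun j => ((tp j).head, none)) = tp :=
  funext fun _ => Tape.write_self _

@[simp] theorem applyActs_onTape (tp : Fin 3 → Tape (Option (Letter r)))
    (act : Fin 3 → Option (Letter r) × Option Dir) (j : Fin 3) (c : Option (Letter r)) (d : Dir) :
    applyActs tp (onTape act j c (some d)) =
      Function.update (applyActs tp act) j (((tp j).write c).move d) := by
  funext k
  by_cases hk : k = j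
  · subst hk
    simp [applyActs, onTape, TuringMachine.applyAct]
  · simp [applyActs, onTape, hk]

/-- A step of the algorithm. -/
def aStep (e : Fin (numWhitehead r) ≃ WhiteheadDatum r) (c : Config r) : Bool ⊕ Config r :=
  (algorithmA e).step c

theorem aStep_inl {e : Fin (numWhitehead r) ≃ WhiteheadDatum r} {q : AState r}
    {tp : Fin 3 → Tape (Option (Letter r))} {b : Bool}
    (h : aTrans e q (fun j => (tp j).head) = .inl b) : aStep e (q, tp) = .inl b := by
  simp only [aStep, TuringMachine.step, algorithmA, h]

theorem aStep_inr {e : Fin (numWhitehead r) ≃ WhiteheadDatum r} {q q' : AState r}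
    {tp tp' : Fin 3 → Tape (Option (Letter r))} {act : Fin 3 → Option (Letter r) × Option Dir}
    (h : aTrans e q (fun j => (tp j).head) = .inr (q', act)) (h' : applyActs tp act = tp') :
    aStep e (q, tp) = .inr (q', tp') := by
  subst h'
  simp only [aStep, TuringMachine.step, algorithmA, h]
  rfl

variable (e : Fin (numWhitehead r) ≃ WhiteheadDatum r) (b : Bool)
  (T C I : Tape (Option (Letter r)))

theorem runs_rewind (i : Fin (numWhitehead r + 1)) (L R : List (Letter r)) :
    Runs (aStep e) (L.length + 1) (.rewind b i, tapes b T (bt L R) I)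
      (.begins b i, tapes b T (wt [] (L.reverse ++ R)) I) := by
  induction L generalizing R with
  | nil =>
    refine Runs.single (aStep_inr (by simp [aTrans]; exact rfl) ?_)
    simp
  | cons x L ih =>
    have := ih (x :: R)
    simp only [List.reverse_cons, List.append_assoc, List.singleton_append, List.length_cons]
    refine Runs.head (aStep_inr (by simp [aTrans]; exact rfl) ?_) this
    simp

/-- Every letter takes two steps: one for the letter kept, one for the letter inserted behind it. -/
theorem runs_image (i : Fin (numWhitehead r)) (f x : Letter r) (L R J : List (Letter r)) :
    Runs (aStep e) (2 * (R.length + 1)) (.keep b i f x, tapes b T (wt L R) (wt J []))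
      (.turn b i, tapes b T (wt (R.reverse ++ L) [])
        (wt (((e i).image f x R).reverse ++ J) [])) := by
  have hkeep : ∀ L R J : List (Letter r), ∀ x,
      aStep e (.keep b i f x, tapes b T (wt L R) (wt J [])) =
        .inr (.glue b i f x, tapes b T (wt L R) (wt (((e i).keep x).toList.reverse ++ J) [])) := by
    intro L R J x
    refine aStep_inr (by simp only [aTrans]; exact rfl) ?_
    cases (e i).keep x <;> simp [appendTo]
  induction R generalizing x L J with
  | nil =>
    refine Runs.head (hkeep _ _ _ _) (Runs.single (aStep_inr (by simp [aTrans]; exact rfl) ?_))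
    rw [WhiteheadDatum.image]
    cases (e i).glue x f <;> simp [appendTo]
  | cons y R ih =>
    have := ih y (y :: L)
      (((e i).glue x y).toList.reverse ++ (((e i).keep x).toList.reverse ++ J))
    simp only [List.length_cons, WhiteheadDatum.image, List.reverse_append, List.reverse_cons,
      List.append_assoc, List.singleton_append] at this ⊢
    refine Runs.head (hkeep _ _ _ _)
      (Runs.head (aStep_inr (by simp [aTrans]; exact rfl) ?_) this)
    cases (e i).glue x y <;> simp [appendTo]

theorem runs_seek (i : Fin (numWhitehead r + 1)) (L R : List (Letter r)) :
    Runs (aStep e) (R.length + 1) (.seek b i, tapes b T C (wt L R))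
      (.wipe b i, tapes b T C (bt (R.reverse ++ L) [])) := by
  induction R generalizing L with
  | nil =>
    refine Runs.single (aStep_inr (by simp [aTrans]; exact rfl) ?_)
    simp
  | cons x R ih =>
    have := ih (x :: L)
    simp only [List.reverse_cons, List.append_assoc, List.singleton_append, List.length_cons]
    refine Runs.head (aStep_inr (by simp [aTrans]; exact rfl) ?_) this
    simp

theorem runs_wipe (i : Fin (numWhitehead r + 1)) (L : List (Letter r)) :
    Runs (aStep e) (L.length + 1) (.wipe b i, tapes b T C (bt L []))
      (.rewind b i, tapes b T C (wt [] [])) := by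
  induction L with
  | nil =>
    refine Runs.single (aStep_inr (by simp [aTrans]; exact rfl) ?_)
    simp [bt_nil_nil]
  | cons x L ih =>
    refine Runs.head (aStep_inr (by simp [aTrans]; exact rfl) ?_) ih
    simp

/-- Erasing a word and going back to the beginning of the current word. -/
theorem runs_seek_to_begins (i : Fin (numWhitehead r + 1)) (L R w : List (Letter r)) :
    Runs (aStep e) (2 * R.length + L.length + 3) (.seek b i, tapes b T (bt [] w) (wt L R))
      (.begins b i, tapes b T (wt [] w) (wt [] [])) := by
  have := ((runs_seek e b T (bt [] w) i L R).trans (runs_wipe e b T _ i _)).trans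
    (runs_rewind e b T _ i [] w)
  refine this.cast ?_
  simp
  omega

/-- Both heads walk left in parallel, and the blank on the image tape is met first. The head on the
old word may stop anywhere inside it, so only the whole content of that tape is recorded; then the
two tapes swap roles. -/
theorem runs_compare_lt (i : Fin (numWhitehead r)) (L R J S : List (Letter r))
    (h : J.length < L.length) :
    ∃ L' R', L'.reverse ++ R' = L.reverse ++ R ∧
      Runs (aStep e) (J.length + 1) (.compare b i, tapes b T (bt L R) (bt J S))
        (.seek (!b) 0, tapes (!b) T (bt [] (J.reverse ++ S)) (wt L' R')) := by
  induction J generalizing L R S with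
  | nil =>
    obtain ⟨x, L, rfl⟩ := List.exists_cons_of_length_pos h
    refine ⟨x :: L, R, rfl, Runs.single (aStep_inr (by simp [aTrans]; exact rfl) ?_)⟩
    simp [tapes_not]
  | cons y J ih =>
    obtain ⟨x, L, rfl⟩ := List.exists_cons_of_length_pos (Nat.zero_lt_of_lt h)
    obtain ⟨L', R', h1, h2⟩ := ih L (x :: R) (y :: S) (by simpa using h)
    refine ⟨L', R', by simp [h1], ?_⟩
    simp only [List.reverse_cons, List.append_assoc, List.singleton_append, List.length_cons]
    refine Runs.head (aStep_inr (by simp [aTrans]; exact rfl) ?_) h2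
    simp

theorem runs_compare_ge (i : Fin (numWhitehead r)) (L R J S : List (Letter r))
    (h : L.length ≤ J.length) :
    ∃ J' S', J'.reverse ++ S' = J.reverse ++ S ∧
      Runs (aStep e) (L.length + 1) (.compare b i, tapes b T (bt L R) (bt J S))
        (.seek b i.succ, tapes b T (bt [] (L.reverse ++ R)) (wt J' S')) := by
  induction L generalizing R J S with
  | nil =>
    refine ⟨J, S, rfl, Runs.single (aStep_inr (by simp [aTrans]; exact rfl) ?_)⟩
    cases J <;> simp
  | cons x L ih =>
    obtain ⟨y, J, rfl⟩ := List.exists_cons_of_length_pos (lt_of_lt_of_le (by simp) h)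
    obtain ⟨J', S', h1, h2⟩ := ih (x :: R) J (y :: S) (by simpa using h)
    refine ⟨J', S', by simp [h1], ?_⟩
    simp only [List.reverse_cons, List.append_assoc, List.singleton_append, List.length_cons]
    refine Runs.head (aStep_inr (by simp [aTrans]; exact rfl) ?_) h2
    simp

theorem length_image_le (φ : WhiteheadDatum r) (f x : Letter r) (l : List (Letter r)) :
    (φ.image f x l).length ≤ 2 * (l.length + 1) := by
  have h1 : ∀ o : Option (Letter r), o.toList.length ≤ 1 := by rintro (_ | _) <;> simp
  induction l generalizing x with
  | nil =>
    have := h1 (φ.keep x)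
    have := h1 (φ.glue x f)
    simp only [WhiteheadDatum.image, List.length_append, List.length_nil]
    omega
  | cons y l ih =>
    have := h1 (φ.keep x)
    have := h1 (φ.glue x y)
    have := ih y
    simp only [WhiteheadDatum.image, List.length_append, List.length_cons]
    omega

/-- The image of the current word is computed. -/
theorem runs_begins_to_compare (i : Fin (numWhitehead r)) (x : Letter r) (l : List (Letter r)) :
    Runs (aStep e) (2 * (l.length + 1) + 2)
      (.begins b i.castSucc, tapes b T (wt [] (x :: l)) (wt [] []))
      (.compare b i, tapes b T (bt (x :: l).reverse []) (bt ((e i).image x x l).reverse [])) := by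
  have h1 : aStep e (.begins b i.castSucc, tapes b T (wt [] (x :: l)) (wt [] [])) =
      .inr (.keep b i x x, tapes b T (wt [x] l) (wt [] [])) :=
    aStep_inr (by simp [aTrans]; exact rfl) (by simp)
  have h2 : aStep e (.turn b i, tapes b T (wt (l.reverse ++ [x]) [])
      (wt (((e i).image x x l).reverse ++ []) [])) =
      .inr (.compare b i, tapes b T (bt (x :: l).reverse [])
        (bt ((e i).image x x l).reverse [])) :=
    aStep_inr (by simp [aTrans]; exact rfl) (by simp)
  exact ((Runs.single h1).trans (runs_image e b T i x x [x] l [])).trans (Runs.single h2) |>.cast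
    (by omega)

/-- An automorphism is tried, and the image is shorter. -/
theorem runs_try_lt (i : Fin (numWhitehead r)) (x : Letter r) (l : List (Letter r))
    (h : ((e i).image x x l).length < (x :: l).length) :
    ∃ t ≤ 7 * (l.length + 2), Runs (aStep e) t
      (.begins b i.castSucc, tapes b T (wt [] (x :: l)) (wt [] []))
      (.begins (!b) 0, tapes (!b) T (wt [] ((e i).image x x l)) (wt [] [])) := by
  obtain ⟨L', R', h1, h2⟩ := runs_compare_lt e b T i (x :: l).reverse []
    ((e i).image x x l).reverse [] (by simpa using h)
  have h3 := runs_seek_to_begins e (!b) T 0 L' R' (((e i).image x x l).reverse.reverse ++ [])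
  rw [List.reverse_reverse, List.append_nil] at h2 h3
  refine ⟨_, ?_, ((runs_begins_to_compare e b T i x l).trans h2).trans h3⟩
  have h4 := congrArg List.length h1
  simp at h4 h ⊢
  omega

/-- An automorphism is tried, and the image is not shorter. -/
theorem runs_try_ge (i : Fin (numWhitehead r)) (x : Letter r) (l : List (Letter r))
    (h : (x :: l).length ≤ ((e i).image x x l).length) :
    ∃ t ≤ 7 * (l.length + 2), Runs (aStep e) t
      (.begins b i.castSucc, tapes b T (wt [] (x :: l)) (wt [] []))
      (.begins b i.succ, tapes b T (wt [] (x :: l)) (wt [] [])) := by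
  obtain ⟨L', R', h1, h2⟩ := runs_compare_ge e b T i (x :: l).reverse []
    ((e i).image x x l).reverse [] (by simpa using h)
  have h3 := runs_seek_to_begins e b T i.succ L' R' ((x :: l).reverse.reverse ++ [])
  rw [List.reverse_reverse, List.append_nil] at h2 h3
  refine ⟨_, ?_, ((runs_begins_to_compare e b T i x l).trans h2).trans h3⟩
  have h4 := congrArg List.length h1
  -- For a word of length n, the image costs 2n + 2 steps and the comparison n + 1. Erasing an image
  -- of length at most 2n and returning costs at most 4n + 3, which makes 7n + 6 in all.
  have h5 := length_image_le (e i) x x l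
  simp at h4 h ⊢
  omega

/-- The Whitehead algorithm decides whether the current word is primitive, in quadratic time. -/
theorem answerWithin_begins [NeZero r] (w : List (Letter r)) (b : Bool) (k : ℕ)
    (i : Fin (numWhitehead r + 1)) (hk : i.1 + k = numWhitehead r)
    (hi : ∀ j : Fin (numWhitehead r), j.1 < i.1 → ∀ x l, w = x :: l →
      w.length ≤ ((e j).image x x l).length) :
    ∃ a : Bool, answerWithin (aStep e)
      (7 * (numWhitehead r + 1) * (w.length * (w.length + 1)) + 7 * k * (w.length + 1) + 2)
      (.begins b i, tapes b T (wt [] w) (wt [] [])) = some a ∧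
      (a = true ↔ IsPrimitive (FreeGroup.mk w)) := by
  induction hn : w.length using Nat.strong_induction_on generalizing w b k i with
  -- The outer induction is on the length of the word, the inner one on the number `k` of
  -- automorphisms still to be tried.
  | _ n ihn =>
  subst hn
  match w with
  | [] =>
    refine ⟨false, answerWithin_mono (answerWithin_one (aStep_inl (by simp [aTrans]))) (by omega),
      by simpa [← FreeGroup.one_eq_mk] using not_isPrimitive_one⟩
  | x :: l =>
    induction k generalizing i with
    | zero =>
      have h1 : aStep e (.begins b i, tapes b T (wt [] (x :: l)) (wt [] [])) =
          .inr (.final b, tapes b T (wt [x] l) (wt [] [])) := by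
        have : ¬ i.1 < numWhitehead r := by omega
        exact aStep_inr (by simp [aTrans, this]; exact rfl) (by simp)
      have h2 : aStep e (.final b, tapes b T (wt [x] l) (wt [] [])) = .inl l.isEmpty :=
        aStep_inl (by cases l <;> simp [aTrans])
      refine ⟨l.isEmpty, (Runs.single h1).answerWithin (answerWithin_one h2) (by omega), ?_⟩
      rw [List.isEmpty_iff]
      constructor
      · rintro rfl
        exact isPrimitive_letter x
      · intro hprim
        -- All automorphisms have been tried in vain, whereas a primitive word of length at least
        -- two can be shortened.
        by_contra hl
        obtain ⟨φ, hφ⟩ := exists_image_length_lt hl hprim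
        have := hi (e.symm φ) (by omega) x l rfl
        rw [Equiv.apply_symm_apply] at this
        omega
    | succ k ihk =>
      obtain ⟨i, rfl⟩ : ∃ i' : Fin (numWhitehead r), i = i'.castSucc :=
        ⟨⟨i.1, by omega⟩, rfl⟩
      by_cases hlt : ((e i).image x x l).length < (x :: l).length
      · obtain ⟨t, ht, hrun⟩ := runs_try_lt e b T i x l hlt
        obtain ⟨a, ha, ha'⟩ := ihn _ hlt ((e i).image x x l) (!b) (numWhitehead r) 0 (by simp)
          (fun j hj => absurd hj (by simp)) rfl
        refine ⟨a, hrun.answerWithin ha ?_, ha'.trans (isPrimitive_mk_image_iff _ _ _)⟩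
        have h1 : ((e i).image x x l).length ≤ l.length := by simpa using hlt
        -- The search restarts from index `0`, but on a shorter word: the drop of the quadratic term
        -- pays for a full new round, and one unit of `k + 1` pays for the present trial.
        calc _ ≤ 7 * (numWhitehead r + 1) * (l.length * (l.length + 1)) +
              7 * numWhitehead r * (l.length + 1) + 2 + 7 * (l.length + 2) := by gcongr
          _ ≤ _ := by simp only [List.length_cons]; ring_nf; nlinarith [Nat.zero_le (k * l.length)]
      · obtain ⟨t, ht, hrun⟩ := runs_try_ge e b T i x l (not_lt.1 hlt)
        obtain ⟨a, ha, ha'⟩ := ihk i.succ (by simp at hk ⊢; omega) (fun j hj x' l' hxl => by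
          cases hxl
          rcases Nat.lt_succ_iff_lt_or_eq.1 (show j.1 < i.1 + 1 by simpa using hj) with h | h
          · exact hi j h x l rfl
          · rw [Fin.ext h]
            exact not_lt.1 hlt)
        refine ⟨a, hrun.answerWithin ha ?_, ha'⟩
        simp only [List.length_cons]
        linarith

end AlgorithmA

/-! ### The fast check -/

section Scan

variable {r : ℕ}

/-- The edges found and the last letter read by the fast check, after the word `l`. -/
def scan (l : List (Letter r)) : Finset (Sym2 (Letter r)) × Option (Letter r) :=
  l.foldl (fun c y => (addEdge c.1 c.2 y, some y)) (∅, none)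

theorem scan_concat (l : List (Letter r)) (y : Letter r) :
    scan (l ++ [y]) = (addEdge (scan l).1 (scan l).2 y, some y) := by
  simp [scan]

theorem scan_snd (l : List (Letter r)) : (scan l).2 = l.getLast? := by
  induction l using List.reverseRecOn with
  | nil => rfl
  | append_singleton l y _ => rw [scan_concat]; simp

theorem exists_of_mem_scan {l : List (Letter r)} {p : Sym2 (Letter r)} (h : p ∈ (scan l).1) :
    ∃ k, ∃ hk : k + 1 < l.length, p = s(l[k], l[k + 1].inv) := by
  induction l using List.reverseRecOn with
  | nil => simp [scan] at h
  | append_singleton l y ih =>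
    have hold : p ∈ (scan l).1 → ∃ k, ∃ hk : k + 1 < (l ++ [y]).length,
        p = s((l ++ [y])[k], (l ++ [y])[k + 1].inv) := by
      intro h
      obtain ⟨k, hk, hp⟩ := ih h
      refine ⟨k, by simp; omega, ?_⟩
      rwa [List.getElem_append_left (by omega), List.getElem_append_left hk]
    rw [scan_concat, scan_snd] at h
    rcases List.eq_nil_or_concat l with rfl | ⟨l, x, hl⟩
    · exact hold h
    · rw [List.concat_eq_append] at hl
      subst hl
      simp only [List.getLast?_concat, addEdge, Finset.mem_insert] at h
      rcases h with rfl | h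
      · exact ⟨l.length, by simp, by simp⟩
      · exact hold h

theorem subset_scan_append (l l' : List (Letter r)) : (scan l).1 ⊆ (scan (l ++ l')).1 := by
  induction l' using List.reverseRecOn with
  | nil => simp
  | append_singleton l' y ih =>
    rw [← List.append_assoc, scan_concat]
    refine ih.trans ?_
    cases (scan (l ++ l')).2 with
    | none => exact Finset.Subset.refl _
    | some x => exact Finset.subset_insert _ _

theorem mem_scan (l l' : List (Letter r)) (x y : Letter r) :
    s(x, y.inv) ∈ (scan (l ++ x :: y :: l')).1 := by
  have h : l ++ x :: y :: l' = ((l ++ [x]) ++ [y]) ++ l' := by simp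
  rw [h]
  refine subset_scan_append _ _ ?_
  rw [scan_concat, scan_snd, List.getLast?_concat]
  exact Finset.mem_insert_self _ _

/-- The Whitehead graph of the word is complete. -/
abbrev IsFull (l : List (Letter r)) : Prop := IsCompleteGraph (scan l).1

theorem IsFull.append {l : List (Letter r)} (h : IsFull l) (l' : List (Letter r)) :
    IsFull (l ++ l') :=
  fun x y hxy => subset_scan_append _ _ (h x y hxy)

theorem IsFull.two_le_length [NeZero r] {l : List (Letter r)} (h : IsFull l) : 2 ≤ l.length := by
  obtain ⟨k, hk, -⟩ := exists_of_mem_scan (h (0, true) (0, false) (by simp))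
  omega

theorem IsFull.not_isPrimitive [NeZero r] {u : List (Letter r)} (h : IsFull u)
    (hu : FreeGroup.IsCyclicallyReduced u) : ¬ IsPrimitive (FreeGroup.mk u) := by
  intro hp
  obtain ⟨p, q, hpq, hne⟩ := exists_missing_edge hu h.two_le_length hp
  obtain ⟨k, hk, he⟩ := exists_of_mem_scan (h p q hpq)
  exact hne k hk he

end Scan

/-! ### The algorithm on a Turing machine -/

namespace AlgorithmA

open Turing WordTape

variable {r : ℕ} (e : Fin (numWhitehead r) ≃ WhiteheadDatum r)

/-- A bound for the time needed by the Whitehead algorithm on a word of length `n`. -/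
def whiteheadTime (r n : ℕ) : ℕ :=
  7 * (numWhitehead r + 1) * (n * (n + 1)) + 7 * numWhitehead r * (n + 1) + 2 + (n + 1)

/-- This is `0` if the Whitehead graph of the word is complete, and `1` otherwise. -/
def notFull (l : List (Letter r)) : ℕ := if IsFull l then 0 else 1

/-- A bound for the time needed when the word `l` has been read and the word `s` remains. -/
def readTime (l s : List (Letter r)) : ℕ :=
  1 + (∑ k ∈ Finset.range s.length, notFull (l ++ s.take (k + 1))) +
    notFull (l ++ s) * whiteheadTime r (l ++ s).length

theorem readTime_cons {l s : List (Letter r)} {y : Letter r} (h : ¬ IsFull (l ++ [y])) :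
    readTime l (y :: s) = readTime (l ++ [y]) s + 1 := by
  have h1 : notFull (l ++ [y]) = 1 := if_neg h
  simp only [readTime, List.length_cons, Finset.sum_range_succ', List.take_succ_cons,
    List.append_assoc, List.singleton_append, List.take_zero, h1]
  omega

/-- The leading `1` in `readTime` pays either for the negative answer of the fast check or for the
step that leaves the reading phase; every letter after which the graph is still incomplete pays for
its own step. -/
theorem answerWithin_read [NeZero r] (l s : List (Letter r)) (hl : ¬ IsFull l)
    (hu : FreeGroup.IsCyclicallyReduced (l ++ s)) :
    ∃ a : Bool, answerWithin (aStep e) (readTime l s)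
      (.read (scan l).1 (scan l).2, tapes false (wt l.reverse s) (wt l.reverse []) (wt [] [])) =
        some a ∧ (a = true ↔ IsPrimitive (FreeGroup.mk (l ++ s))) := by
  induction s generalizing l with
  | nil =>
    obtain ⟨a, ha, ha'⟩ := answerWithin_begins e (wt l.reverse []) l false (numWhitehead r) 0
      (by simp) (fun j hj => absurd hj (by simp))
    have h1 : aStep e (.read (scan l).1 (scan l).2,
        tapes false (wt l.reverse []) (wt l.reverse []) (wt [] [])) =
        .inr (.rewind false 0, tapes false (wt l.reverse []) (bt l.reverse []) (wt [] [])) :=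
      aStep_inr (by simp [aTrans]; exact rfl) (by simp)
    have h2 := runs_rewind e false (wt l.reverse []) (wt [] []) 0 l.reverse []
    rw [List.reverse_reverse, List.append_nil] at h2
    refine ⟨a, ((Runs.single h1).trans h2).answerWithin ha ?_, by rwa [List.append_nil]⟩
    rw [readTime, List.append_nil, notFull, if_neg hl, whiteheadTime]
    simp
    omega
  | cons y s ih =>
    have hsplit : l ++ y :: s = (l ++ [y]) ++ s := by simp
    by_cases hfull : IsFull (l ++ [y])
    · refine ⟨false, answerWithin_mono (answerWithin_one (aStep_inl ?_))
        (by rw [readTime]; omega), ?_⟩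
      · have := hfull
        rw [IsFull, scan_concat] at this
        simp only [aTrans, tapes_zero, wt_head_cons]
        exact if_pos this
      · rw [hsplit] at hu ⊢
        simpa using (hfull.append s).not_isPrimitive hu
    · rw [hsplit] at hu ⊢
      obtain ⟨a, ha, ha'⟩ := ih (l ++ [y]) hfull hu
      have h1 : aStep e (.read (scan l).1 (scan l).2,
          tapes false (wt l.reverse (y :: s)) (wt l.reverse []) (wt [] [])) =
          .inr (.read (scan (l ++ [y])).1 (scan (l ++ [y])).2,
            tapes false (wt (l ++ [y]).reverse s) (wt (l ++ [y]).reverse []) (wt [] [])) := by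
        have := hfull
        rw [IsFull, scan_concat] at this
        rw [scan_concat]
        refine aStep_inr (act := appendTo (onTape (fun j =>
          ((tapes false (wt l.reverse (y :: s)) (wt l.reverse []) (wt [] []) j).head, none))
            0 (some y) (some .right)) (curTape false) (some y)) ?_ ?_
        · simp only [aTrans, tapes_zero, wt_head_cons]
          exact if_neg this
        · simp [appendTo]
      exact ⟨a, (Runs.single h1).answerWithin ha (readTime_cons hfull).ge, ha'⟩

theorem answerWithin_start [NeZero r] (u : List (Letter r))
    (hu : FreeGroup.IsCyclicallyReduced u) :
    ∃ a : Bool, answerWithin (algorithmA e).step (readTime [] u)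
      ((algorithmA e).start (u.map some)) = some a ∧ (a = true ↔ IsPrimitive (FreeGroup.mk u)) := by
  have h0 : ¬ IsFull ([] : List (Letter r)) := fun h => by simpa using h.two_le_length
  have h := answerWithin_read e [] u h0 hu
  have hstart : (algorithmA e).start (u.map some) =
      (.read (scan []).1 (scan []).2, tapes false (wt [] u) (wt [] []) (wt [] [])) := by
    refine Prod.ext rfl (funext fun j => ?_)
    fin_cases j <;> rfl
  rw [hstart]
  exact h

end AlgorithmA

/-! ### The algorithm on a machine with double-ended queues -/

namespace DequeAlgorithm

open Turing

variable {r : ℕ} (e : Fin (numWhitehead r) ≃ WhiteheadDatum r)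

/-- The tapes that are kept in the queues. -/
def toTapes (Q : Fin 3 × Bool → List (Option (Letter r))) (j : Fin 3) : Tape (Option (Letter r)) :=
  Tape.mk' (ListBlank.mk (Q (j, false))) (ListBlank.mk (Q (j, true)))

theorem head?_getD (l : List (Option (Letter r))) : l.head?.getD none = l.headI := by
  cases l <;> rfl

/-- Each half of a tape is a queue up to trailing blanks; an empty queue acts as an all-blank half,
consistently with popping it being harmless. -/
theorem toTapes_apply (L R : List (Option (Letter r))) (p : Option (Letter r) × Option Dir) :
    Tape.mk'
        (ListBlank.mk ((tapeOps (L.head?.getD none) p false).foldl DequeOp.apply L))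
        (ListBlank.mk ((tapeOps (L.head?.getD none) p true).foldl DequeOp.apply R)) =
      TuringMachine.applyAct (Tape.mk' (ListBlank.mk L) (ListBlank.mk R)) p := by
  obtain ⟨c, _ | _ | _⟩ := p
  · simp [tapeOps, TuringMachine.applyAct, DequeOp.apply, Tape.write_mk']
  · simp [tapeOps, TuringMachine.applyAct, DequeOp.apply, Tape.write_mk', Tape.move_left_mk',
      head?_getD]
  · simp [tapeOps, TuringMachine.applyAct, DequeOp.apply, Tape.write_mk', Tape.move_right_mk']

/-- The machine with queues simulates the Turing machine step by step. -/
theorem answerWithin_some (t : ℕ) (q : AState r) (Q : Fin 3 × Bool → List (Option (Letter r))) :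
    answerWithin (dequeAlgorithm e).step t (some q, Q) =
      answerWithin (algorithmA e).step t (q, toTapes Q) := by
  induction t generalizing q Q with
  | zero => rfl
  | succ t ih =>
    have hs : (fun j => ((Q (j, true)).head?).getD none) = fun j => (toTapes Q j).head := by
      funext j
      simp [toTapes, head?_getD]
    rw [answerWithin, answerWithin]
    simp only [DequeMachine.step, dequeAlgorithm, TuringMachine.step, algorithmA, hs]
    cases h : aTrans e q fun j => (toTapes Q j).head with
    | inl a => rfl
    | inr p =>
      obtain ⟨q', act⟩ := p
      refine (ih q' _).trans ?_
      congr 2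
      funext j
      exact toTapes_apply _ _ _

/-- The queues at the beginning. -/
def queues (u : List (Letter r)) (j : Fin 3 × Bool) : List (Option (Letter r)) :=
  if j = (0, true) then u.map some else []

theorem step_cancel (a : Letter r) (m : List (Letter r)) :
    (dequeAlgorithm e).step (none, queues (a :: (m ++ [a.inv]))) = .inr (none, queues m) := by
  have : cancels ((queues (a :: (m ++ [a.inv])) (0, true)).head?,
      (queues (a :: (m ++ [a.inv])) (0, true)).getLast?) = true := by
    simp [queues, cancels, List.getLast?_cons]
  simp only [DequeMachine.step, dequeAlgorithm, this, if_true]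
  refine congrArg Sum.inr (Prod.ext rfl (funext fun j => ?_))
  by_cases hj : j = (0, true)
  · simp [hj, queues, DequeOp.apply]
  · simp [hj, queues]

theorem step_start {u : List (Letter r)} (hu : FreeGroup.IsCyclicallyReduced u) :
    (dequeAlgorithm e).step (none, queues u) = .inr (some (.read ∅ none), queues u) := by
  have : cancels ((queues u (0, true)).head?, (queues u (0, true)).getLast?) = false := by
    cases h : u.head? with
    | none => simp [queues, cancels, h]
    | some a =>
      cases h' : u.getLast? with
      | none => simp [List.getLast?_eq_none_iff.1 h'] at h
      | some z =>
        have := hu.2 z h' a h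
        simp only [queues, if_true, List.head?_map, List.getLast?_map, h, h', Option.map_some,
          cancels, decide_eq_false_iff_not]
        rintro rfl
        simp [Letter.inv] at this
  simp only [DequeMachine.step, dequeAlgorithm, this]
  rfl

theorem toTapes_queues (u : List (Letter r)) :
    (AState.read ∅ none, toTapes (queues u)) = (algorithmA e).start (u.map some) := by
  refine Prod.ext rfl (funext fun j => ?_)
  fin_cases j <;> rfl

/-- A reduced word is cyclically reduced, or its first and last letters cancel. -/
theorem isCyclicallyReduced_or {u : List (Letter r)} (hu : FreeGroup.IsReduced u) :
    FreeGroup.IsCyclicallyReduced u ∨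
      ∃ a m, u = a :: (m ++ [Letter.inv a]) ∧ FreeGroup.IsReduced m := by
  induction u using List.bidirectionalRec with
  | nil => exact Or.inl .nil
  | singleton x => exact Or.inl .singleton
  | cons_append a m b _ =>
    by_cases h : a.1 = b.1 ∧ a ≠ b
    · refine Or.inr ⟨a, m, ?_, (hu.right_of_append (l₁ := [a])).left_of_append⟩
      rcases Letter.eq_or_eq_inv h.1 with h1 | h1
      · exact absurd h1 h.2
      · rw [h1, Letter.inv_inv]
    · left
      have := FreeGroup.isCyclicallyReduced_cons_append_iff (L := m) (a := b) (b := a)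
      rw [List.cons_append] at this
      refine this.2 ⟨hu, fun h1 => ?_⟩
      by_contra h2
      exact h ⟨h1.symm, fun h3 => h2 (by rw [h3])⟩

open Classical in
/-- A bound for the time needed by the algorithm. -/
noncomputable def time (n : ℕ) (u : List (Letter r)) : ℕ :=
  match n with
  | 0 => 0
  | n + 1 =>
    if FreeGroup.IsCyclicallyReduced u then AlgorithmA.readTime [] u + 1
    else time n u.tail.dropLast + 1

/-- The number `n` is fuel exceeding the length of the word. Deleting a cancelling pair of end
letters only conjugates the element. -/
theorem answerWithin_start [NeZero r] (n : ℕ) (u : List (Letter r)) (hn : u.length < n)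
    (hu : FreeGroup.IsReduced u) :
    ∃ a : Bool, answerWithin (dequeAlgorithm e).step (time n u) (none, queues u) = some a ∧
      (a = true ↔ IsPrimitive (FreeGroup.mk u)) := by
  induction n generalizing u with
  | zero => omega
  | succ n ih =>
    by_cases hc : FreeGroup.IsCyclicallyReduced u
    · obtain ⟨a, ha, ha'⟩ := AlgorithmA.answerWithin_start e u hc
      rw [time, if_pos hc]
      refine ⟨a, (Runs.single (step_start e hc)).answerWithin ?_ le_rfl, ha'⟩
      refine (answerWithin_some e _ _ _).trans ?_
      exact (congrArg (answerWithin (algorithmA e).step _) (toTapes_queues e u)).trans ha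
    · obtain ⟨x, m, rfl, hm⟩ := (isCyclicallyReduced_or hu).resolve_left hc
      obtain ⟨a, ha, ha'⟩ := ih m (by simp at hn; omega) hm
      rw [time, if_neg hc]
      refine ⟨a, (Runs.single (step_cancel e x m)).answerWithin ha (by simp), ha'.trans ?_⟩
      have : FreeGroup.mk (x :: (m ++ [x.inv])) =
          FreeGroup.mk [x] * FreeGroup.mk m * (FreeGroup.mk [x])⁻¹ := by
        rw [← WhiteheadDatum.mk_inv, FreeGroup.mul_mk, FreeGroup.mul_mk]
        rfl
      rw [this, isPrimitive_conj_iff]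

end DequeAlgorithm

/-! ### Counting reduced words -/

section Counting

variable {r : ℕ}

theorem reduced_pair_iff {x y : Letter r} : (x.1 = y.1 → x.2 = y.2) ↔ y ≠ x.inv := by
  obtain ⟨i, b⟩ := x
  obtain ⟨j, c⟩ := y
  cases b <;> cases c <;> simp [Letter.inv, eq_comm]

theorem isReduced_cons_cons_iff {x y : Letter r} {l : List (Letter r)} :
    FreeGroup.IsReduced (x :: y :: l) ↔ y ≠ x.inv ∧ FreeGroup.IsReduced (y :: l) := by
  rw [FreeGroup.isReduced_cons_cons, reduced_pair_iff]

/-- The words of length `n` that can follow the letter `p` in a reduced word. -/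
def extensions (p : Letter r) : ℕ → Finset (List (Letter r))
  | 0 => {[]}
  | n + 1 => (Finset.univ.erase p.inv).biUnion fun y => (extensions y n).image (y :: ·)

theorem mem_extensions {p : Letter r} {n : ℕ} {s : List (Letter r)} :
    s ∈ extensions p n ↔ s.length = n ∧ FreeGroup.IsReduced (p :: s) := by
  induction n generalizing p s with
  | zero =>
    rw [extensions, Finset.mem_singleton, List.length_eq_zero_iff]
    exact ⟨fun h => ⟨h, h ▸ .singleton⟩, fun h => h.1⟩
  | succ n ih =>
    simp only [extensions, Finset.mem_biUnion, Finset.mem_erase, Finset.mem_univ, and_true,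
      Finset.mem_image]
    constructor
    · rintro ⟨y, hy, l, hl, rfl⟩
      obtain ⟨h1, h2⟩ := ih.1 hl
      exact ⟨by simp [h1], isReduced_cons_cons_iff.2 ⟨hy, h2⟩⟩
    · rintro ⟨h1, h2⟩
      match s with
      | [] => simp at h1
      | y :: l =>
        rw [isReduced_cons_cons_iff] at h2
        exact ⟨y, h2.1, l, ih.2 ⟨by simpa using h1, h2.2⟩, rfl⟩

theorem card_extensions (p : Letter r) (n : ℕ) : (extensions p n).card = (2 * r - 1) ^ n := by
  induction n generalizing p with
  | zero => rfl
  | succ n ih =>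
    rw [extensions, Finset.card_biUnion]
    · simp only [Finset.card_image_of_injective _ (List.cons_injective), ih, Finset.sum_const,
        Finset.card_erase_of_mem (Finset.mem_univ _), Finset.card_univ, smul_eq_mul]
      rw [pow_succ']
      congr 2
      simp
      omega
    · intro y _ z _ hyz
      rw [Function.onFun, Finset.disjoint_left]
      intro l hl hl'
      simp only [Finset.mem_image] at hl hl'
      obtain ⟨l₁, -, rfl⟩ := hl
      obtain ⟨l₂, -, h⟩ := hl'
      exact hyz (List.cons.inj h).1.symm

/-- The reduced words of length `n`. -/
def redLists (r : ℕ) : ℕ → Finset (List (Letter r))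
  | 0 => {[]}
  | n + 1 => Finset.univ.biUnion fun y => (extensions y n).image (y :: ·)

theorem mem_redLists {n : ℕ} {l : List (Letter r)} :
    l ∈ redLists r n ↔ l.length = n ∧ FreeGroup.IsReduced l := by
  match n, l with
  | 0, l =>
    rw [redLists, Finset.mem_singleton, List.length_eq_zero_iff]
    exact ⟨fun h => ⟨h, h ▸ .nil⟩, fun h => h.1⟩
  | n + 1, [] => simp [redLists]
  | n + 1, x :: l => simp [redLists, mem_extensions]

theorem card_redLists_succ (n : ℕ) : (redLists r (n + 1)).card = 2 * r * (2 * r - 1) ^ n := by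
  rw [redLists, Finset.card_biUnion]
  · simp only [Finset.card_image_of_injective _ (List.cons_injective), card_extensions,
      Finset.sum_const, Finset.card_univ, smul_eq_mul]
    congr 1
    simp [mul_comm]
  · intro y _ z _ hyz
    rw [Function.onFun, Finset.disjoint_left]
    intro l hl hl'
    simp only [Finset.mem_image] at hl hl'
    obtain ⟨l₁, -, rfl⟩ := hl
    obtain ⟨l₂, -, h⟩ := hl'
    exact hyz (List.cons.inj h).1.symm

/-- The first letter has 2r choices and each later one 2r - 1, hence the restriction to `1 ≤ k`. -/
theorem card_redLists_add {k : ℕ} (hk : 1 ≤ k) (n : ℕ) :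
    (redLists r (k + n)).card = (redLists r k).card * (2 * r - 1) ^ n := by
  obtain ⟨k, rfl⟩ := Nat.exists_eq_add_of_le' hk
  rw [show k + 1 + n = k + n + 1 by omega, card_redLists_succ, card_redLists_succ, pow_add,
    ← mul_assoc]

/-- The last letter of a nonempty word. -/
def lastLetter [NeZero r] (l : List (Letter r)) : Letter r := l.getLastD (0, true)

theorem isReduced_append_iff [NeZero r] {l s : List (Letter r)} (hl : l ≠ []) :
    FreeGroup.IsReduced (l ++ s) ↔
      FreeGroup.IsReduced l ∧ FreeGroup.IsReduced (lastLetter l :: s) := by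
  obtain ⟨l, z, rfl⟩ := (List.eq_nil_or_concat l).resolve_left hl
  rw [List.concat_eq_append]
  have : lastLetter (l ++ [z]) = z := by simp [lastLetter]
  rw [this]
  constructor
  · intro h
    refine ⟨List.IsChain.left_of_append h, ?_⟩
    rw [List.append_assoc] at h
    exact List.IsChain.right_of_append h
  · rintro ⟨h1, h2⟩
    exact FreeGroup.IsReduced.append_overlap h1 h2 (by simp)

/-! ### The fast check fails rarely -/

theorem subset_scan_append_right (l s : List (Letter r)) : (scan s).1 ⊆ (scan (l ++ s)).1 := by
  intro p hp
  obtain ⟨k, hk, rfl⟩ := exists_of_mem_scan hp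
  have h : l ++ s = (l ++ s.take k) ++ s[k] :: s[k + 1] :: s.drop (k + 2) := by
    rw [List.append_assoc, ← List.drop_eq_getElem_cons, ← List.drop_eq_getElem_cons,
      List.take_append_drop]
  rw [h]
  exact mem_scan _ _ _ _

/-- In rank at least two, use `m x y⁻¹` with a buffer letter `m` different from `p⁻¹` and `x⁻¹`. In
rank one there is no such letter, but the only edge is produced by `p p`. -/
theorem exists_extension_edge [NeZero r] (p x y : Letter r) (hxy : x ≠ y) :
    ∃ s, FreeGroup.IsReduced (p :: s) ∧ s(x, y) ∈ (scan s).1 := by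
  by_cases hr : r = 1
  · subst hr
    have h1 : ∀ z z' : Letter 1, z = z' ∨ z = z'.inv := fun z z' =>
      Letter.eq_or_eq_inv (Subsingleton.elim _ _)
    refine ⟨[p, p], ?_, ?_⟩
    · simp
    · have h2 : s(x, y) = s(p, p.inv) := by
        have hx := h1 x p
        have hy := h1 y p
        rcases hx with rfl | rfl <;> rcases hy with rfl | rfl
        · exact absurd rfl hxy
        · rfl
        · exact Sym2.eq_swap
        · exact absurd rfl hxy
      rw [h2]
      exact mem_scan [] [] p p
  · have hcard : ({p.inv, x.inv} : Finset (Letter r)).card < Fintype.card (Letter r) := by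
      refine lt_of_le_of_lt Finset.card_le_two ?_
      have := NeZero.pos r
      simp
      omega
    obtain ⟨m, hm⟩ := Finset.exists_mem_notMem_of_card_lt_card
      (s := {p.inv, x.inv}) (t := Finset.univ) (by simpa using hcard)
    simp only [Finset.mem_insert, Finset.mem_singleton, not_or] at hm
    refine ⟨[m, x, y.inv], ?_, ?_⟩
    · simp only [isReduced_cons_cons_iff, FreeGroup.IsReduced.singleton, and_true]
      refine ⟨hm.2.1, fun h => hm.2.2 ?_, fun h => hxy ?_⟩
      · rw [h, Letter.inv_inv]
      · rw [← Letter.inv_inv x, ← h, Letter.inv_inv]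
    · have := mem_scan [m] [] x y.inv
      rwa [Letter.inv_inv] at this

/-- Concatenate such extensions, one for every pair of distinct letters; edges once found are never
lost. -/
theorem exists_extension_isFull [NeZero r] (p : Letter r) :
    ∃ s, FreeGroup.IsReduced (p :: s) ∧ IsFull s := by
  have key : ∀ P : Finset (Letter r × Letter r), (∀ c ∈ P, c.1 ≠ c.2) → ∃ s,
      FreeGroup.IsReduced (p :: s) ∧ ∀ c ∈ P, s(c.1, c.2) ∈ (scan s).1 := by
    intro P
    induction P using Finset.induction_on with
    | empty => exact fun _ => ⟨[], .singleton, by simp⟩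
    | insert c P _ ih =>
      intro hP
      obtain ⟨s, hs, hsP⟩ := ih fun d hd => hP d (Finset.mem_insert_of_mem hd)
      obtain ⟨s', hs', hc⟩ := exists_extension_edge (lastLetter (p :: s)) c.1 c.2
        (hP c (Finset.mem_insert_self _ _))
      refine ⟨s ++ s', ?_, fun d hd => ?_⟩
      · rw [← List.cons_append]
        exact (isReduced_append_iff (by simp)).2 ⟨hs, hs'⟩
      · rcases Finset.mem_insert.1 hd with rfl | hd
        · exact subset_scan_append_right _ _ hc
        · exact subset_scan_append _ _ (hsP d hd)
  obtain ⟨s, hs, h⟩ := key (Finset.univ.filter fun c => c.1 ≠ c.2) (by simp)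
  exact ⟨s, hs, fun x y hxy => h (x, y) (by simpa using hxy)⟩

/-- After any letter, there is a word of length `L` whose Whitehead graph is complete. -/
theorem exists_block [NeZero r] :
    ∃ L, 1 ≤ L ∧ ∀ p : Letter r, ∃ s ∈ extensions p L, IsFull s := by
  choose s hs hfull using exists_extension_isFull (r := r)
  refine ⟨Finset.univ.sup (fun p => (s p).length) + 1, by omega, fun p => ?_⟩
  -- Repeating the last letter keeps a word reduced, so all blocks can be padded to a common length.
  have key : ∀ n, (s p).length ≤ n → ∃ s', s' ∈ extensions p n ∧ IsFull s' := by
    intro n hn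
    induction n, hn using Nat.le_induction with
    | base => exact ⟨s p, mem_extensions.2 ⟨rfl, hs p⟩, hfull p⟩
    | succ n _ ih =>
      obtain ⟨s', hs', hfull'⟩ := ih
      rw [mem_extensions] at hs'
      refine ⟨s' ++ [lastLetter (p :: s')], mem_extensions.2 ⟨by simp [hs'.1], ?_⟩,
        hfull'.append _⟩
      rw [← List.cons_append, isReduced_append_iff (by simp)]
      refine ⟨hs'.2, ?_⟩
      simp
  exact key _ ((Finset.le_sup (f := fun p => (s p).length) (Finset.mem_univ p)).trans
    (Nat.le_succ _))

/-- The reduced words of length `n` whose Whitehead graph is not complete. -/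
def badLists (r n : ℕ) : Finset (List (Letter r)) := (redLists r n).filter fun l => ¬ IsFull l

theorem card_badLists_le (n : ℕ) : (badLists r n).card ≤ (redLists r n).card :=
  Finset.card_filter_le _ _

theorem exists_append_of_mem_redLists [NeZero r] {k n : ℕ} (hk : 1 ≤ k) {l : List (Letter r)}
    (hl : l ∈ redLists r (k + n)) :
    ∃ l' s, l = l' ++ s ∧ l' = l.take k ∧ l' ∈ redLists r k ∧ s ∈ extensions (lastLetter l') n := by
  rw [mem_redLists] at hl
  have hlen : (l.take k).length = k := by simp; omega
  have hne : l.take k ≠ [] := fun h => by rw [h] at hlen; simp at hlen; omega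
  have h := hl.2
  rw [← List.take_append_drop k l, isReduced_append_iff hne] at h
  refine ⟨l.take k, l.drop k, (List.take_append_drop k l).symm, rfl, mem_redLists.2 ⟨hlen, h.1⟩,
    mem_extensions.2 ⟨by simp; omega, h.2⟩⟩

/-- An incomplete word has an incomplete prefix, and at least one of the (2r-1)^L continuations of
that prefix makes the graph complete. -/
theorem card_badLists_add_le [NeZero r] {L : ℕ}
    (hL : ∀ p : Letter r, ∃ s ∈ extensions p L, IsFull s) {k : ℕ} (hk : 1 ≤ k) :
    (badLists r (k + L)).card ≤ (badLists r k).card * ((2 * r - 1) ^ L - 1) := by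
  classical
  choose g hg hfull using hL
  have hsub : badLists r (k + L) ⊆ (badLists r k).biUnion fun l =>
      ((extensions (lastLetter l) L).erase (g (lastLetter l))).image (l ++ ·) := by
    intro l hl
    obtain ⟨hl1, hl2⟩ := Finset.mem_filter.1 hl
    obtain ⟨l', s, rfl, -, h1, h2⟩ := exists_append_of_mem_redLists hk hl1
    refine Finset.mem_biUnion.2 ⟨l', Finset.mem_filter.2 ⟨h1, fun h => hl2 (h.append s)⟩,
      Finset.mem_image.2 ⟨s, Finset.mem_erase.2 ⟨?_, h2⟩, rfl⟩⟩
    rintro rfl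
    exact hl2 fun x y hxy => subset_scan_append_right _ _ (hfull _ x y hxy)
  refine (Finset.card_le_card hsub).trans (Finset.card_biUnion_le_card_mul _ _ _ fun l _ => ?_)
  refine Finset.card_image_le.trans ?_
  rw [Finset.card_erase_of_mem (hg _), card_extensions]

/-- The probability that the fast check has not stopped after `k` letters decays exponentially. -/
theorem exists_card_badLists_le [NeZero r] : ∃ K ρ : ℝ, 0 ≤ K ∧ 0 < ρ ∧ ρ < 1 ∧
    ∀ k, ((badLists r k).card : ℝ) ≤ K * ρ ^ k * (redLists r k).card := by
  obtain ⟨L, hL1, hL⟩ := exists_block (r := r)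
  have hN : 1 ≤ 2 * r - 1 := by have := NeZero.pos r; omega
  set N : ℕ := 2 * r - 1 with hNdef
  have hNL : 1 ≤ N ^ L := Nat.one_le_pow _ _ hN
  have hNLr : (1 : ℝ) ≤ (N : ℝ) ^ L := by exact_mod_cast hNL
  have hLr : (1 : ℝ) ≤ L := by exact_mod_cast hL1
  -- Chosen so that Bernoulli's inequality gives N^L - 1 ≤ (1-δ)^L N^L, the decay over one block,
  -- without extracting roots. The factor L + 1 instead of L keeps δ below 1 even if L = 1 and N =
  -- 1.
  set δ : ℝ := 1 / ((L + 1) * N ^ L) with hδ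
  have hδ0 : 0 < δ := by positivity
  have hδ1 : δ < 1 := by
    rw [hδ, div_lt_one (by positivity)]
    nlinarith
  have hbern : (N : ℝ) ^ L - 1 ≤ (1 - δ) ^ L * N ^ L := by
    have h1 := one_add_mul_le_pow (a := -δ) (by linarith) L
    have h2 : L * δ * N ^ L ≤ 1 := by
      rw [hδ]
      field_simp
      linarith
    have h3 : 1 - L * δ ≤ (1 - δ) ^ L := by
      calc 1 - L * δ = 1 + L * -δ := by ring
        _ ≤ (1 + -δ) ^ L := h1
        _ = _ := by ring_nf
    nlinarith
  set ρ : ℝ := 1 - δ with hρ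
  have hρ0 : 0 < ρ := by linarith
  have hρ1 : ρ < 1 := by linarith
  -- The constant makes the bound trivial for k ≤ L, where the induction over blocks of length L
  -- starts.
  refine ⟨(ρ ^ L)⁻¹, ρ, by positivity, hρ0, hρ1, fun k => ?_⟩
  suffices h : ((badLists r k).card : ℝ) * ρ ^ L ≤ ρ ^ k * (redLists r k).card by
    rw [mul_assoc, ← div_eq_inv_mul, le_div_iff₀ (by positivity)]
    exact h
  induction k using Nat.strong_induction_on with
  | _ k ih =>
    by_cases hk : k ≤ L
    · have h1 : ((badLists r k).card : ℝ) ≤ (redLists r k).card := by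
        exact_mod_cast card_badLists_le k
      have h2 : ρ ^ L ≤ ρ ^ k := pow_le_pow_of_le_one hρ0.le hρ1.le hk
      calc _ ≤ ((redLists r k).card : ℝ) * ρ ^ k := by gcongr
        _ = _ := mul_comm _ _
    · obtain ⟨j, rfl⟩ : ∃ j, k = j + L := ⟨k - L, by omega⟩
      have hj : 1 ≤ j := by omega
      have h1 := card_badLists_add_le hL hj
      have h2 : ((badLists r (j + L)).card : ℝ) ≤ (badLists r j).card * ((N : ℝ) ^ L - 1) := by
        have : (((N ^ L - 1 : ℕ)) : ℝ) = (N : ℝ) ^ L - 1 := by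
          rw [Nat.cast_sub hNL]
          simp
        rw [← this]
        exact_mod_cast h1
      have h3 := ih j (by omega)
      have h4 : ((redLists r (j + L)).card : ℝ) = (redLists r j).card * (N : ℝ) ^ L := by
        rw [card_redLists_add hj]
        push_cast
        rfl
      calc ((badLists r (j + L)).card : ℝ) * ρ ^ L
          ≤ (badLists r j).card * ((N : ℝ) ^ L - 1) * ρ ^ L := by gcongr
        _ = ((badLists r j).card * ρ ^ L) * ((N : ℝ) ^ L - 1) := by ring
        _ ≤ (ρ ^ j * (redLists r j).card) * (ρ ^ L * N ^ L) := by
            gcongr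
        _ = ρ ^ (j + L) * (redLists r (j + L)).card := by rw [h4, pow_add]; ring

open AlgorithmA in
theorem sum_notFull_take_le [NeZero r] {k n : ℕ} (hk : 1 ≤ k) :
    (∑ l ∈ redLists r (k + n), notFull (l.take k)) ≤ (badLists r k).card * (2 * r - 1) ^ n := by
  classical
  have h1 : (∑ l ∈ redLists r (k + n), notFull (l.take k)) =
      ((redLists r (k + n)).filter fun l => ¬ IsFull (l.take k)).card := by
    rw [Finset.card_filter]
    refine Finset.sum_congr rfl fun l _ => ?_
    rw [notFull]
    split_ifs <;> rfl
  have hsub : ((redLists r (k + n)).filter fun l => ¬ IsFull (l.take k)) ⊆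
      (badLists r k).biUnion fun l => (extensions (lastLetter l) n).image (l ++ ·) := by
    intro l hl
    obtain ⟨hl1, hl2⟩ := Finset.mem_filter.1 hl
    obtain ⟨l', s, h0, h1, h2, h3⟩ := exists_append_of_mem_redLists hk hl1
    rw [← h1] at hl2
    exact Finset.mem_biUnion.2 ⟨l', Finset.mem_filter.2 ⟨h2, hl2⟩,
      Finset.mem_image.2 ⟨s, h3, h0.symm⟩⟩
  rw [h1]
  refine (Finset.card_le_card hsub).trans (Finset.card_biUnion_le_card_mul _ _ _ fun l _ => ?_)
  exact Finset.card_image_le.trans (card_extensions _ _).le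

/-- A quadratic polynomial times a decaying geometric sequence tends to zero. -/
theorem bddAbove_whiteheadTime {ρ : ℝ} (h0 : 0 < ρ) (h1 : ρ < 1) :
    ∃ D : ℝ, ∀ n, (AlgorithmA.whiteheadTime r n : ℝ) * ρ ^ n ≤ D := by
  have habs : |ρ| < 1 := by rwa [abs_of_pos h0]
  have ht : ∀ j : ℕ, Filter.Tendsto (fun n : ℕ => (n : ℝ) ^ j * ρ ^ n) Filter.atTop (nhds 0) :=
    fun j => tendsto_pow_const_mul_const_pow_of_abs_lt_one j habs
  set M : ℝ := ((numWhitehead r : ℕ) : ℝ)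
  have hlim := (((ht 2).const_mul (7 * (M + 1))).add
    ((ht 1).const_mul (7 * (M + 1) + 7 * M + 1))).add ((ht 0).const_mul (7 * M + 3))
  obtain ⟨D, hD⟩ := hlim.bddAbove_range
  refine ⟨D, fun n => le_trans (le_of_eq ?_) (hD ⟨n, rfl⟩)⟩
  simp only [AlgorithmA.whiteheadTime]
  push_cast
  ring

open AlgorithmA in
/-- The sum of the runtimes over all reduced words. -/
theorem exists_sum_readTime_le (r : ℕ) [NeZero r] :
    ∃ C : ℕ, ∀ n, ∑ l ∈ redLists r n, readTime [] l ≤ C * (redLists r n).card := by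
  obtain ⟨K, ρ, hK, hρ0, hρ1, hbad⟩ := exists_card_badLists_le (r := r)
  obtain ⟨D, hD⟩ := bddAbove_whiteheadTime (r := r) hρ0 hρ1
  refine ⟨⌈1 + K * (1 - ρ)⁻¹ + K * D⌉₊, fun n => ?_⟩
  have hle := Nat.le_ceil (1 + K * (1 - ρ)⁻¹ + K * D)
  set R : ℝ := ((redLists r n).card : ℝ) with hR
  have hR0 : 0 ≤ R := Nat.cast_nonneg _
  suffices h : ((∑ l ∈ redLists r n, readTime [] l : ℕ) : ℝ) ≤ (1 + K * (1 - ρ)⁻¹ + K * D) * R by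
    have : ((∑ l ∈ redLists r n, readTime [] l : ℕ) : ℝ) ≤
        ((⌈1 + K * (1 - ρ)⁻¹ + K * D⌉₊ * (redLists r n).card : ℕ) : ℝ) := by
      rw [Nat.cast_mul]
      exact h.trans (by gcongr)
    exact_mod_cast this
  -- Exchanging the sums turns the total reading time into the numbers of words whose prefix of a
  -- given length still has an incomplete graph.
  have hsplit : ∑ l ∈ redLists r n, readTime [] l =
      (redLists r n).card + (∑ k ∈ Finset.range n, ∑ l ∈ redLists r n, notFull (l.take (k + 1))) +
        (badLists r n).card * whiteheadTime r n := by
    rw [Finset.sum_comm, Finset.card_eq_sum_ones, badLists, Finset.card_filter, Finset.sum_mul,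
      ← Finset.sum_add_distrib, ← Finset.sum_add_distrib]
    refine Finset.sum_congr rfl fun l hl => ?_
    have hlen := (mem_redLists.1 hl).1
    rw [readTime, hlen, List.nil_append, notFull, hlen]
    simp only [List.nil_append, ite_not]
  have hread : ((∑ k ∈ Finset.range n, ∑ l ∈ redLists r n, notFull (l.take (k + 1)) : ℕ) : ℝ) ≤
      K * (1 - ρ)⁻¹ * R := by
    have h1 : ∀ k ∈ Finset.range n,
        ((∑ l ∈ redLists r n, notFull (l.take (k + 1)) : ℕ) : ℝ) ≤ K * ρ ^ (k + 1) * R := by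
      intro k hk
      obtain ⟨m, rfl⟩ : ∃ m, n = k + 1 + m := ⟨n - (k + 1), by
        have := Finset.mem_range.1 hk; omega⟩
      have h2 := sum_notFull_take_le (r := r) (k := k + 1) (n := m) (by omega)
      have h3 : ((∑ l ∈ redLists r (k + 1 + m), notFull (l.take (k + 1)) : ℕ) : ℝ) ≤
          (badLists r (k + 1)).card * (((2 * r - 1 : ℕ) : ℝ) ^ m) := by exact_mod_cast h2
      rw [hR, card_redLists_add (by omega), Nat.cast_mul, Nat.cast_pow, ← mul_assoc]
      exact h3.trans (by gcongr; exact hbad _)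
    rw [Nat.cast_sum]
    calc _ ≤ ∑ k ∈ Finset.range n, K * ρ ^ (k + 1) * R := Finset.sum_le_sum h1
      _ ≤ ∑ k ∈ Finset.range n, K * R * ρ ^ k := by
          refine Finset.sum_le_sum fun k _ => ?_
          have h4 : ρ ^ (k + 1) ≤ ρ ^ k := pow_le_pow_of_le_one hρ0.le hρ1.le (by omega)
          calc K * ρ ^ (k + 1) * R ≤ K * ρ ^ k * R := by gcongr
            _ = _ := by ring
      _ = K * R * ∑ k ∈ Finset.range n, ρ ^ k := by rw [Finset.mul_sum]
      _ ≤ K * R * (1 - ρ)⁻¹ := by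
          gcongr
          rw [← tsum_geometric_of_lt_one hρ0.le hρ1]
          exact (summable_geometric_of_lt_one hρ0.le hρ1).sum_le_tsum _
            fun _ _ => pow_nonneg hρ0.le _
      _ = _ := by ring
  have hwh : ((badLists r n).card * whiteheadTime r n : ℝ) ≤ K * D * R := by
    calc ((badLists r n).card * whiteheadTime r n : ℝ) ≤ (K * ρ ^ n * R) * whiteheadTime r n := by
          gcongr
          exact hbad n
      _ = K * R * (whiteheadTime r n * ρ ^ n) := by ring
      _ ≤ K * R * D := by gcongr; exact hD n
      _ = _ := by ring
  rw [hsplit]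
  push_cast at hread ⊢
  linarith

end Counting

/-! ### Expected runtimes -/

section Expectation

variable {r : ℕ}

theorem redLists_eq_image (r n : ℕ) [DecidableEq (List (Letter r))] :
    redLists r n = (reducedWords r n).image List.ofFn := by
  ext l
  rw [mem_redLists, Finset.mem_image]
  constructor
  · rintro ⟨rfl, h⟩
    exact ⟨l.get, by simpa [reducedWords] using h, List.ofFn_get l⟩
  · rintro ⟨w, hw, rfl⟩
    exact ⟨List.length_ofFn, by simpa [reducedWords] using hw⟩

open Classical in
/-- The cyclically reduced words of length `n`. -/
noncomputable def cycLists (r n : ℕ) : Finset (List (Letter r)) :=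
  (redLists r n).filter FreeGroup.IsCyclicallyReduced

open Classical in
theorem cycLists_eq_image (r n : ℕ) :
    cycLists r n = (cyclicallyReducedWords r n).image List.ofFn := by
  ext l
  rw [cycLists, Finset.mem_filter, mem_redLists, Finset.mem_image]
  constructor
  · rintro ⟨⟨rfl, -⟩, h⟩
    exact ⟨l.get, by simpa [cyclicallyReducedWords] using h, List.ofFn_get l⟩
  · rintro ⟨w, hw, rfl⟩
    have hw : FreeGroup.IsCyclicallyReduced (List.ofFn w) := by
      simpa [cyclicallyReducedWords] using hw
    exact ⟨⟨List.length_ofFn, hw.isReduced⟩, hw⟩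

open Classical in
theorem expectation_le {n : ℕ} {S : Finset (Fin n → Letter r)} {X : List (Letter r) → ℕ∞}
    {f : List (Letter r) → ℕ} {C : ℕ} (hX : ∀ l ∈ S.image List.ofFn, X l ≤ f l)
    (hf : ∑ l ∈ S.image List.ofFn, f l ≤ C * (S.image List.ofFn).card) :
    expectation S X ≤ ((C : ℝ≥0) : ℝ≥0∞) := by
  rw [Finset.sum_image (List.ofFn_injective.injOn),
    Finset.card_image_of_injective _ List.ofFn_injective] at hf
  refine ENNReal.div_le_of_le_mul ?_
  calc ∑ w ∈ S, (X (List.ofFn w) : ℝ≥0∞) ≤ ∑ w ∈ S, ((f (List.ofFn w) : ℕ) : ℝ≥0∞) := by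
        refine Finset.sum_le_sum fun w hw => ?_
        have := hX _ (Finset.mem_image_of_mem _ hw)
        exact_mod_cast ENat.toENNReal_le.2 this
    _ ≤ _ := by exact_mod_cast hf

theorem isReduced_rank_one {x y : Letter 1} {l : List (Letter 1)}
    (h : FreeGroup.IsReduced (x :: l)) (hy : y ∈ l) : y = x := by
  induction l generalizing x with
  | nil => simp at hy
  | cons z l ih =>
    rw [isReduced_cons_cons_iff] at h
    have hz : z = x := (Letter.eq_or_eq_inv (Subsingleton.elim _ _)).resolve_right h.1
    rcases List.mem_cons.1 hy with rfl | hy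
    · exact hz
    · rw [ih h.2 hy, hz]

/-- A reduced word that is not cyclically reduced has length at least three, and the rank is at
least two. -/
theorem two_le_rank_of_not_isCyclicallyReduced [NeZero r] {a : Letter r} {m : List (Letter r)}
    (h : FreeGroup.IsReduced (a :: (m ++ [a.inv]))) : 2 ≤ r ∧ m ≠ [] := by
  refine ⟨?_, ?_⟩
  · by_contra hr
    obtain rfl : r = 1 := by have := NeZero.pos r; omega
    exact Letter.inv_ne a (isReduced_rank_one h (by simp))
  · rintro rfl
    rw [List.nil_append, isReduced_cons_cons_iff] at h
    exact h.1 rfl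

/-- Only the inverses of the first and of the last letter are forbidden, and there are at least four
letters. -/
theorem exists_concat_isCyclicallyReduced [NeZero r] (hr : 2 ≤ r) {l : List (Letter r)}
    (hl : FreeGroup.IsReduced l) (hne : l ≠ []) :
    ∃ y, FreeGroup.IsCyclicallyReduced (l ++ [y]) := by
  obtain ⟨x, l, rfl⟩ := List.exists_cons_of_ne_nil hne
  have hcard : ({(lastLetter (x :: l)).inv, x.inv} : Finset (Letter r)).card <
      Fintype.card (Letter r) := by
    refine lt_of_le_of_lt Finset.card_le_two ?_
    simp
    omega
  obtain ⟨y, hy⟩ := Finset.exists_mem_notMem_of_card_lt_card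
    (s := {(lastLetter (x :: l)).inv, x.inv}) (t := Finset.univ) (by simpa using hcard)
  simp only [Finset.mem_insert, Finset.mem_singleton, not_or] at hy
  refine ⟨y, FreeGroup.isCyclicallyReduced_cons_append_iff.2 ⟨?_, ?_⟩⟩
  · rw [isReduced_append_iff (by simp)]
    exact ⟨hl, isReduced_cons_cons_iff.2 ⟨hy.2.1, .singleton⟩⟩
  · refine reduced_pair_iff.2 fun h => hy.2.2 ?_
    rw [h, Letter.inv_inv]

/-- A positive fraction of the reduced words is cyclically reduced. -/
theorem card_redLists_le [NeZero r] (n : ℕ) :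
    (redLists r n).card ≤ 2 * r * (cycLists r n).card := by
  classical
  have hrpos := NeZero.pos r
  by_cases h : 2 ≤ r ∧ 2 ≤ n
  · obtain ⟨k, rfl⟩ : ∃ k, n = k + 1 + 1 := ⟨n - 2, by omega⟩
    have hy : ∀ l ∈ redLists r (k + 1), ∃ y, FreeGroup.IsCyclicallyReduced (l ++ [y]) := by
      intro l hl
      obtain ⟨h1, h2⟩ := mem_redLists.1 hl
      exact exists_concat_isCyclicallyReduced h.1 h2 (fun h => by simp [h] at h1)
    choose! y hy using hy
    -- Appending a suitable last letter is injective, and passing from length n - 1 to n multiplies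
    -- the number of reduced words only by 2r - 1.
    have h1 : (redLists r (k + 1)).card ≤ (cycLists r (k + 1 + 1)).card := by
      refine Finset.card_le_card_of_injOn (fun l => l ++ [y l]) (fun l hl => ?_) ?_
      · refine Finset.mem_filter.2 ⟨mem_redLists.2 ⟨?_, (hy l hl).isReduced⟩, hy l hl⟩
        simp [(mem_redLists.1 hl).1]
      · intro l _ l' _ heq
        exact (List.append_inj' heq rfl).1
    rw [card_redLists_add (by omega), pow_one, mul_comm]
    gcongr
    omega
  -- In rank one, or for n ≤ 1, every reduced word is cyclically reduced.
  · have : cycLists r n = redLists r n := by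
      refine Finset.filter_true_of_mem fun l hl => ?_
      obtain ⟨h1, h2⟩ := mem_redLists.1 hl
      refine (DequeAlgorithm.isCyclicallyReduced_or h2).resolve_right ?_
      rintro ⟨a, m, rfl, -⟩
      refine h ⟨(two_le_rank_of_not_isCyclicallyReduced h2).1, ?_⟩
      rw [← h1]
      simp
    rw [this]
    nlinarith

/-- The sum of the runtimes of the algorithm with queues over all reduced words. -/
theorem sum_time_le [NeZero r] {C : ℕ}
    (hC : ∀ n, ∑ l ∈ redLists r n, AlgorithmA.readTime [] l ≤ C * (redLists r n).card)
    (n m : ℕ) (hm : n < m) :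
    ∑ l ∈ redLists r n, DequeAlgorithm.time m l ≤ (2 * C + 3) * (redLists r n).card := by
  classical
  induction n using Nat.strong_induction_on generalizing m with
  | _ n ih =>
    obtain ⟨m, rfl⟩ : ∃ m', m = m' + 1 := ⟨m - 1, by omega⟩
    rw [← Finset.sum_filter_add_sum_filter_not (redLists r n) FreeGroup.IsCyclicallyReduced]
    have h1 : ∑ l ∈ (redLists r n).filter FreeGroup.IsCyclicallyReduced,
        DequeAlgorithm.time (m + 1) l ≤ (C + 1) * (redLists r n).card := by
      calc _ = ∑ l ∈ (redLists r n).filter FreeGroup.IsCyclicallyReduced,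
            (AlgorithmA.readTime [] l + 1) := Finset.sum_congr rfl fun l hl => by
              rw [DequeAlgorithm.time, if_pos (Finset.mem_filter.1 hl).2]
        _ ≤ ∑ l ∈ redLists r n, (AlgorithmA.readTime [] l + 1) :=
            Finset.sum_le_sum_of_subset (Finset.filter_subset _ _)
        _ ≤ _ := by
            rw [Finset.sum_add_distrib, ← Finset.card_eq_sum_ones, add_mul, one_mul]
            gcongr
            exact hC n
    set B := (redLists r n).filter fun l => ¬ FreeGroup.IsCyclicallyReduced l with hB
    have hB' : ∀ l ∈ B, ∃ a k, l = a :: (k ++ [Letter.inv a]) ∧ k ∈ redLists r (n - 2) ∧ 2 ≤ r ∧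
        3 ≤ n := by
      intro l hl
      obtain ⟨hl1, hl2⟩ := Finset.mem_filter.1 hl
      obtain ⟨h2, h3⟩ := mem_redLists.1 hl1
      obtain ⟨a, k, rfl, hk⟩ := (DequeAlgorithm.isCyclicallyReduced_or h3).resolve_left hl2
      obtain ⟨hr, hne⟩ := two_le_rank_of_not_isCyclicallyReduced h3
      have := List.length_pos_iff.2 hne
      simp at h2
      exact ⟨a, k, rfl, mem_redLists.2 ⟨by omega, hk⟩, hr, by omega⟩
    -- A word in `B` is determined by its first letter and a reduced word of length n - 2. Since 4r
    -- ≤ (2r-1)² for r ≥ 2, such pairs number at most half of the reduced words of length n. The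
    -- constant c = 2C + 3 solves c = (C + 1) + (c + 1)/2; the inequality is doubled to avoid
    -- fractions.
    have h2 : 2 * ∑ l ∈ B, DequeAlgorithm.time (m + 1) l ≤
        (2 * C + 4) * (redLists r n).card := by
      rcases B.eq_empty_or_nonempty with h0 | ⟨l, hl⟩
      · simp [h0]
      · obtain ⟨-, -, -, -, hr, hn⟩ := hB' l hl
        let g : Letter r × List (Letter r) → List (Letter r) := fun p => p.1 :: (p.2 ++ [p.1.inv])
        have hsub : B ⊆ (Finset.univ ×ˢ redLists r (n - 2)).image g := by
          intro l hl
          obtain ⟨a, k, rfl, hk, -, -⟩ := hB' l hl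
          exact Finset.mem_image.2 ⟨(a, k), by simp [hk], rfl⟩
        have hginj : Function.Injective g := by
          rintro ⟨a, k⟩ ⟨a', k'⟩ h
          obtain ⟨h3, h4⟩ := List.cons.inj h
          exact Prod.ext h3 (List.append_inj' h4 rfl).1
        have h3 : ∑ l ∈ B, DequeAlgorithm.time (m + 1) l ≤
            2 * r * ((2 * C + 4) * (redLists r (n - 2)).card) := by
          calc _ = ∑ l ∈ B, (DequeAlgorithm.time m l.tail.dropLast + 1) :=
                Finset.sum_congr rfl fun l hl => by
                  rw [DequeAlgorithm.time, if_neg (Finset.mem_filter.1 hl).2]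
            _ ≤ ∑ l ∈ (Finset.univ ×ˢ redLists r (n - 2)).image g,
                (DequeAlgorithm.time m l.tail.dropLast + 1) := Finset.sum_le_sum_of_subset hsub
            _ = ∑ _a : Letter r, ∑ k ∈ redLists r (n - 2), (DequeAlgorithm.time m k + 1) := by
                rw [Finset.sum_image hginj.injOn, Finset.sum_product]
                simp [g]
            _ ≤ ∑ _a : Letter r, (2 * C + 4) * (redLists r (n - 2)).card := by
                refine Finset.sum_le_sum fun a _ => ?_
                rw [Finset.sum_add_distrib, ← Finset.card_eq_sum_ones]
                have := ih (n - 2) (by omega) m (by omega)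
                linarith
            _ = _ := by
                rw [Finset.sum_const, Finset.card_univ, smul_eq_mul, Fintype.card_prod,
                  Fintype.card_fin, Fintype.card_bool]
                ring
        have h4 : (redLists r n).card = (redLists r (n - 2)).card * (2 * r - 1) ^ 2 := by
          rw [← card_redLists_add (by omega)]
          congr 2
          omega
        have h5 : 4 * r ≤ (2 * r - 1) ^ 2 := by
          obtain ⟨s, rfl⟩ := Nat.exists_eq_add_of_le hr
          rw [show 2 * (2 + s) - 1 = 3 + 2 * s by omega]
          nlinarith
        rw [h4]
        calc _ ≤ 2 * (2 * r * ((2 * C + 4) * (redLists r (n - 2)).card)) := by gcongr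
          _ = (2 * C + 4) * ((redLists r (n - 2)).card * (4 * r)) := by ring
          _ ≤ _ := by gcongr
    nlinarith

end Expectation

/-! ### Correctness and constant expected runtime -/

theorem theorem1 (r : ℕ) [NeZero r] :
    ∃ C : ℝ≥0, ∀ e : Fin (numWhitehead r) ≃ WhiteheadDatum r,
      ((∀ u : List (Letter r), FreeGroup.IsCyclicallyReduced u →
          ∃ b : Bool, (algorithmA e).Answers (u.map some) b ∧
            (b = true ↔ IsPrimitive (FreeGroup.mk u))) ∧
        ∀ n : ℕ, expectation (cyclicallyReducedWords r n)
          (fun u => (algorithmA e).runtime (u.map some)) ≤ C) ∧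
      ((∀ u : List (Letter r), FreeGroup.IsReduced u →
          ∃ b : Bool, (dequeAlgorithm e).Answers (u.map some) b ∧
            (b = true ↔ IsPrimitive (FreeGroup.mk u))) ∧
        ∀ n : ℕ, expectation (reducedWords r n)
          (fun u => (dequeAlgorithm e).runtime (u.map some)) ≤ C) := by
  classical
  obtain ⟨C, hC⟩ := exists_sum_readTime_le r
  have hmax : ∀ k : ℕ, k ≤ max (C * (2 * r)) (2 * C + 3) →
      ((k : ℝ≥0) : ℝ≥0∞) ≤ (((max (C * (2 * r)) (2 * C + 3) : ℕ) : ℝ≥0) : ℝ≥0∞) := by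
    intro k hk
    exact_mod_cast hk
  refine ⟨((max (C * (2 * r)) (2 * C + 3) : ℕ) : ℝ≥0), fun e => ⟨⟨fun u hu => ?_, fun n => ?_⟩,
    fun u hu => ?_, fun n => ?_⟩⟩
  · obtain ⟨a, ha, ha'⟩ := AlgorithmA.answerWithin_start e u hu
    exact ⟨a, ⟨_, ha⟩, ha'⟩
  · refine (expectation_le (f := AlgorithmA.readTime []) (C := C * (2 * r)) (fun l hl => ?_)
      ?_).trans (hmax _ (le_max_left _ _))
    · rw [← cycLists_eq_image] at hl
      obtain ⟨a, ha, -⟩ := AlgorithmA.answerWithin_start e l (Finset.mem_filter.1 hl).2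
      exact stepCount_le ha
    · rw [← cycLists_eq_image]
      calc _ ≤ ∑ l ∈ redLists r n, AlgorithmA.readTime [] l :=
            Finset.sum_le_sum_of_subset (Finset.filter_subset _ _)
        _ ≤ C * (redLists r n).card := hC n
        _ ≤ C * (2 * r * (cycLists r n).card) := by gcongr; exact card_redLists_le n
        _ = _ := by ring
  · obtain ⟨a, ha, ha'⟩ := DequeAlgorithm.answerWithin_start e (u.length + 1) u (by omega) hu
    exact ⟨a, ⟨_, ha⟩, ha'⟩
  · refine (expectation_le (f := DequeAlgorithm.time (n + 1)) (C := 2 * C + 3) (fun l hl => ?_)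
      ?_).trans (hmax _ (le_max_right _ _))
    · rw [← redLists_eq_image] at hl
      obtain ⟨h1, h2⟩ := mem_redLists.1 hl
      obtain ⟨a, ha, -⟩ := DequeAlgorithm.answerWithin_start e (n + 1) l (by omega) h2
      exact stepCount_le ha
    · rw [← redLists_eq_image]
      exact sum_time_le hC n (n + 1) (by omega)
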